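/- Setting. For $a>0$ let $\mathbb S^3_a=\{(z,w)\in\mathbb C^2: |z|^2/a^2+|w|^2=1\}$, and let $\Omega_a$ be the orbit space $\{(z,r)\in\mathbb C\times[0,\infty):|z|^2/a^2+r^2=1\}$ of the action of $\{1\}\times\mathbb S^1$ by multiplication on $w$, with the metric $V^2\check{\mathrm g}_a$, where $\check{\mathrm g}_a$ is induced from $\mathbb R^3$ and $V=2\pi r$. With $\rho(\phi)=2\pi\int_0^\phi\cos\xi\sqrt{a^2\cos^2\xi+\sin^2\xi}\,d\xi$, $L_a=\rho(\pi/2)$ and inverse function $\phi(\rho)$, polar coordinates $(\rho,\theta)$, $0<\rho<L_a$, on $\Omega_a$ are given by $z=a e^{i\theta}\sin\phi(\rho)$, $r=\cos\phi(\rho)$. Fix a family of functions $\beta_a:(-1,1)\to(0,L_a)$, $a>0$, with $(a,s)\mapsto\beta_a(s)$ real analytic, $\beta_a'(s)>0$, and $\beta_a(0)=\rho(\pi/4)$ (the radius of the Clifford geodesic). Let $\gamma_{a,s}(t)=(\rho_{a,s}(t),\theta_{a,s}(t))$, $t\in\mathbb R$, be the geodesic of $\Omega_a$ with $\gamma_{a,s}(0)=(\beta_a(s),0)$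 and $\dot\gamma_{a,s}(0)=(0,1)$, where $\theta_{a,s}$ takes values in $\mathbb R$; for an integer $k\ge1$ let $\ell_k(a,s)>0$ be the time with $\theta_{a,s}(\ell_k(a,s))=k\pi$, and let $$f_k:(0,\infty)\times(-1,1)\to\mathbb R,\qquad f_k(a,s)=\dot\rho_{a,s}(\ell_k(a,s)).$$ Let $\mathcal B_{\mathrm{triv}}=\{(a,0):a>0\}$. Proposition. For all $a>0$ and $s\in(-1,1)$ the geodesic $\gamma_{a,s}$ exists on all of $\mathbb R$ and is unique, and the time $\ell_k(a,s)>0$ exists and is unique. Fix an integer $k\ge1$ and, for each integer $0<j<2k$, let $a^j_k=\dfrac{j/k}{\sqrt{4-(j/k)^2}}$. (i) For each integer $0<j<2k$ there are an open neighborhood $U$ of $(a^j_k,0)$ in $(0,\infty)\times(-1,1)$, an $\varepsilon>0$ and a real analytic curve $(-\varepsilon,\varepsilon)\ni t\mapsto(a(t),s(t))\in U$ with $(a(0),s(0))=(a^j_k,0)$ and $s'(0)>0$ such that $$f_k^{-1}(0)\cap U=(\mathcal B_{\mathrm{triv}}\cap U)\cup\{(a(t),s(t)):t\in(-\varepsilon,\varepsilon)\}.$$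 (ii) If $a>0$ and $a\ne a^j_k$ for all integers $0<j<2k$, there is an open neighborhood $V$ of $(a,0)$ in $(0,\infty)\times(-1,1)$ such that $f_k^{-1}(0)\cap V=\mathcal B_{\mathrm{triv}}\cap V$. Consequently, if $a>0$ and $a\neq a^j_k$ for all integers $0<j<2k$, the $k$-fold covering $$F_0(u,v)=\tfrac1{\sqrt2}\big(a\,e^{iku},e^{iv}\big),\qquad (u,v)\in(\mathbb R/2\pi\mathbb Z)^2,$$ of the Clifford torus $\{|z|^2/a^2=|w|^2=\tfrac12\}$ is locally unique among $\{1\}\times\mathbb S^1$-invariant immersed minimal tori in $\mathbb S^3_a$: there is $\delta>0$ such that every smooth minimal immersion $F:(\mathbb R/2\pi\mathbb Z)^2\to\mathbb S^3_a$ that maps each circle $\{u\}\times(\mathbb R/2\pi\mathbb Z)$ into an orbit of $\{1\}\times\mathbb S^1$ and is $\delta$-close to $F_0$ in the $C^1$ sense is of the form $F=F_0\circ\Phi$ with a diffeomorphism $\Phi$ of the torus $(\mathbb R/2\pi\mathbb Z)^2$. -/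

import Mathlib

open scoped ContDiff

namespace EllipsoidTori

noncomputable section

/-! ### The orbit space `Ω_a` in polar coordinates -/

/-- The arclength function `ρ(φ) = 2π ∫₀^φ cos ξ √(a² cos² ξ + sin² ξ) dξ`, `φ ∈ [0, π/2]`. -/
def arclength (a φ : ℝ) : ℝ :=
  2 * Real.pi * ∫ ξ in (0 : ℝ)..φ,
    Real.cos ξ * Real.sqrt (a ^ 2 * Real.cos ξ ^ 2 + Real.sin ξ ^ 2)

/-- The radius `L_a = ρ(π/2)` of the disk `Ω_a`. -/
def diskRadius (a : ℝ) : ℝ := arclength a (Real.pi / 2)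

/-- `φ(ρ)`: the inverse of `ρ : [0, π/2] → [0, L_a]`. -/
def polarAngle (a ρ : ℝ) : ℝ :=
  Function.invFunOn (arclength a) (Set.Icc 0 (Real.pi / 2)) ρ

/-- The point `(x, y, r)` of the orbit space `{|z|²/a² + r² = 1, r ≥ 0}` with polar
coordinates `(ρ, θ)`, where `z = x + i y`. -/
def orbitPoint (a : ℝ) (p : ℝ × ℝ) : EuclideanSpace ℝ (Fin 3) :=
  !₂[a * Real.cos p.2 * Real.sin (polarAngle a p.1),
     a * Real.sin p.2 * Real.sin (polarAngle a p.1),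
     Real.cos (polarAngle a p.1)]

/-- The volume function of the orbits, `V = 2π r`. -/
def orbitVolume (a : ℝ) (p : ℝ × ℝ) : ℝ := 2 * Real.pi * orbitPoint a p 2

/-- The metric `V² ǧ_a` of `Ω_a` in the coordinates `(ρ, θ)`: here `ǧ_a` is the metric induced
from `ℝ³` on the orbit space. -/
def orbitMetric (a : ℝ) (p v w : ℝ × ℝ) : ℝ :=
  orbitVolume a p ^ 2 *
    inner ℝ (fderiv ℝ (orbitPoint a) p v) (fderiv ℝ (orbitPoint a) p w)

/-- `γ(t) = (ρ(t), θ(t))`, `t ∈ ℝ`, is an affinely parametrized geodesic in the interior of `Ω_a`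
that avoids the center `O = {ρ = 0}`; the angle `θ` is lifted to `ℝ`. The geodesic equation
`g_{kj} γ̈^j + Γ_{k,ij} γ̇^i γ̇^j = 0` is written as the Euler-Lagrange equation of the energy:
`d/dt g(γ̇, e) = ½ (∂_e g)(γ̇, γ̇)` for every constant vector `e`. -/
def IsGeodesic (a : ℝ) (γ : ℝ → ℝ × ℝ) : Prop :=
  ContDiff ℝ 2 γ ∧ (∀ t, (γ t).1 ∈ Set.Ioo 0 (diskRadius a)) ∧
  ∀ t : ℝ, ∀ e : ℝ × ℝ,
    HasDerivAt (fun τ => orbitMetric a (γ τ) (deriv γ τ) e)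
      ((1 / 2) * fderiv ℝ (fun p => orbitMetric a p (deriv γ t) (deriv γ t)) (γ t) e) t

/-! ### The geodesics `γ_{a,s}` and the functions `f_k` -/

/-- The parameter domain `(0, ∞) × (-1, 1)`. -/
def strip : Set (ℝ × ℝ) := Set.Ioi 0 ×ˢ Set.Ioo (-1) 1

/-- `β a s = β_a(s)` is a real analytic family of parametrizations of the radial segment `σ(0)`
by increasing functions `β_a : (-1, 1) → (0, L_a)` for which `β_a(0)` is the radius of the
Clifford geodesic, i.e. the `ρ` with `φ(ρ) = π/4`. -/
structure IsRadialParametrization (β : ℝ → ℝ → ℝ) : Prop where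
  analytic : AnalyticOnNhd ℝ (fun p : ℝ × ℝ => β p.1 p.2) strip
  mem_Ioo : ∀ a s : ℝ, (a, s) ∈ strip → β a s ∈ Set.Ioo 0 (diskRadius a)
  at_zero : ∀ a : ℝ, 0 < a → β a 0 = arclength a (Real.pi / 4)
  deriv_pos : ∀ a s : ℝ, (a, s) ∈ strip → 0 < deriv (β a) s

/-- `γ` is the geodesic of `Ω_a` that starts orthogonally to `σ(0)`, with
`γ(0) = (β_a(s), 0)` and `γ̇(0) = (0, 1)`. -/
def IsOrthogonalGeodesic (β : ℝ → ℝ → ℝ) (a s : ℝ) (γ : ℝ → ℝ × ℝ) : Prop :=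
  IsGeodesic a γ ∧ γ 0 = (β a s, 0) ∧ deriv γ 0 = (0, 1)

/-- The geodesic `γ_{a,s}`. -/
def orthGeodesic (β : ℝ → ℝ → ℝ) (a s : ℝ) : ℝ → ℝ × ℝ :=
  Classical.epsilon (IsOrthogonalGeodesic β a s)

/-- `ℓ_k(a, s)`: the time `t > 0` with `θ_{a,s}(t) = k π`. -/
def hittingTime (β : ℝ → ℝ → ℝ) (k : ℕ) (a s : ℝ) : ℝ :=
  sInf {t : ℝ | 0 < t ∧ (orthGeodesic β a s t).2 = k * Real.pi}

/-- `f_k(a, s) = ρ̇_{a,s}(ℓ_k(a, s))`. -/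
def closingFun (β : ℝ → ℝ → ℝ) (k : ℕ) (a s : ℝ) : ℝ :=
  deriv (fun t => (orthGeodesic β a s t).1) (hittingTime β k a s)

/-- The zero set of `f_k` in `(0, ∞) × (-1, 1)`. -/
def zeroSet (β : ℝ → ℝ → ℝ) (k : ℕ) : Set (ℝ × ℝ) :=
  {p | p ∈ strip ∧ closingFun β k p.1 p.2 = 0}

/-- The trivial branch `{(a, 0) : a > 0}`. -/
def trivialBranch : Set (ℝ × ℝ) := {p | 0 < p.1 ∧ p.2 = 0}

/-- `a^j_k = (j/k) / √(4 - (j/k)²)`. -/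
def bifInstant (j k : ℕ) : ℝ :=
  ((j : ℝ) / k) / Real.sqrt (4 - ((j : ℝ) / k) ^ 2)

/-! ### Minimal tori in the ellipsoid `|z|²/a² + |w|² = 1` in `ℂ²`

An immersed torus is given by a map `F(u, v)` on `ℝ²` that is `2π`-periodic in both variables. -/

/-- The ellipsoid `𝕊³_a`. -/
def ellipsoid (a : ℝ) : Set (ℂ × ℂ) := {q | ‖q.1‖ ^ 2 / a ^ 2 + ‖q.2‖ ^ 2 = 1}

/-- The Euclidean inner product of `ℂ² = ℝ⁴`. -/
def dot (p q : ℂ × ℂ) : ℝ := inner ℝ p.1 q.1 + inner ℝ p.2 q.2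

/-- `N` is tangent to the ellipsoid at `q`. -/
def IsTangent (a : ℝ) (q N : ℂ × ℂ) : Prop :=
  inner ℝ q.1 N.1 / a ^ 2 + inner ℝ q.2 N.2 = 0

/-- The partial derivative in `u`. -/
def du (F : ℝ × ℝ → ℂ × ℂ) (p : ℝ × ℝ) : ℂ × ℂ := fderiv ℝ F p (1, 0)

/-- The partial derivative in `v`. -/
def dv (F : ℝ × ℝ → ℂ × ℂ) (p : ℝ × ℝ) : ℂ × ℂ := fderiv ℝ F p (0, 1)

/-- `F` is a smooth minimal immersion of the torus `(ℝ/2πℤ)²` into the ellipsoid: the trace of its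
second fundamental form vanishes in every direction `N` that is tangent to the ellipsoid
and normal to the surface. -/
structure IsMinimalTorus (a : ℝ) (F : ℝ × ℝ → ℂ × ℂ) : Prop where
  smooth : ContDiff ℝ ∞ F
  periodic_u : ∀ u v : ℝ, F (u + 2 * Real.pi, v) = F (u, v)
  periodic_v : ∀ u v : ℝ, F (u, v + 2 * Real.pi) = F (u, v)
  mem : ∀ p, F p ∈ ellipsoid a
  immersion : ∀ p, LinearIndependent ℝ ![du F p, dv F p]
  minimal : ∀ (p : ℝ × ℝ) (N : ℂ × ℂ),
    IsTangent a (F p) N → dot (du F p) N = 0 → dot (dv F p) N = 0 →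
    dot (dv F p) (dv F p) * dot (du (du F) p) N
      - 2 * dot (du F p) (dv F p) * dot (du (dv F) p) N
      + dot (du F p) (du F p) * dot (dv (dv F) p) N = 0

/-- The torus is `{1} × 𝕊¹`-invariant: `F` maps each parallel circle `u = const` into an orbit of
the action of the unit complex numbers on the second coordinate `w`. -/
def IsCircleInvariant (F : ℝ × ℝ → ℂ × ℂ) : Prop :=
  ∀ u v : ℝ, ∃ α : ℝ,
    F (u, v) = ((F (u, 0)).1, Complex.exp (α * Complex.I) * (F (u, 0)).2)

/-- The `k`-fold covering of the Clifford torus `|z|²/a² = |w|² = 1/2`. -/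
def cliffordCover (a : ℝ) (k : ℕ) (p : ℝ × ℝ) : ℂ × ℂ :=
  ((a / Real.sqrt 2 : ℝ) * Complex.exp ((k * p.1 : ℝ) * Complex.I),
   (1 / Real.sqrt 2 : ℝ) * Complex.exp ((p.2 : ℝ) * Complex.I))

/-- `F` and `G` are `δ`-close in the `C¹` sense. -/
def C1Close (δ : ℝ) (F G : ℝ × ℝ → ℂ × ℂ) : Prop :=
  ∀ p, ‖F p - G p‖ < δ ∧ ‖fderiv ℝ F p - fderiv ℝ G p‖ < δ

/-- `Φ` is the lift to `ℝ²` of a diffeomorphism of the torus `(ℝ/2πℤ)²` that acts trivially on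
the fundamental group. -/
structure IsTorusReparam (Φ : ℝ × ℝ ≃ ℝ × ℝ) : Prop where
  smooth : ContDiff ℝ ∞ Φ
  smooth_symm : ContDiff ℝ ∞ Φ.symm
  shift_u : ∀ u v : ℝ, Φ (u + 2 * Real.pi, v) = Φ (u, v) + (2 * Real.pi, 0)
  shift_v : ∀ u v : ℝ, Φ (u, v + 2 * Real.pi) = Φ (u, v) + (0, 2 * Real.pi)

end

end EllipsoidTori

open EllipsoidTori

open Set Filter Topology

namespace EllipsoidTori

noncomputable section

/-! ### The radial coordinate -/

/-! In the coordinate `x = cos 2φ` the geodesic flow of the orbit space can be integrated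
explicitly. The metric is `dρ² + π² a² (1 - x²) dθ²`, so a geodesic conserves the angular momentum
`(1 - x²) θ̇` and its energy. For a geodesic that starts orthogonally to a radial segment at `x =
x₀`, these two laws say that `x` and a suitable multiple `D` of `ρ̇ √(1 - x²)` satisfy `x' = -W D`,
`D' = W x` (`eq_rotation`). Hence `x = x₀ cos ψ` for a phase `ψ`, and time and polar angle are
increasing functions of `ψ` given by integrals (`phaseTime`, `phaseAngle`). This yields existence
for all times, uniqueness (`IsGeodesic.eq_modelGeodesic`) and the hitting times.

Since `ρ̇` is a positive multiple of `x₀ sin ψ`, the function `f_k` vanishes exactly when `x₀ = 0`,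
which is the trivial branch, or when the angle `kπ` is reached at a phase `mπ`. With `H(a, x₀)` the
gain of angle over a phase `π` (`halfPeriod`), the second condition is `m H = kπ` for some `m ≥ 1`
(`closingFun_eq_zero_iff`). Thus the nontrivial zeros form level sets of one analytic positive
function. On the trivial branch `H = π √(a² + 1) / (2a)`, which is strictly decreasing in `a` and
takes the value `kπ/m` exactly at `a = a^m_k` with `m < 2k`. Away from these values no level set
comes near. At `a^j_k` only `m = j` matters, and the implicit function theorem solves `j H = kπ` for
`a` as an analytic function of `s`. Analyticity of `H` is obtained by viewing integrands as elements
of the Banach algebra `C(X, ℝ)`.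

For tori, `C¹`-closeness to the Clifford covering gives global angles and a polar form
(`exists_isPolarForm`), and minimality tested on one normal field says that the profile curve is an
unparametrized geodesic. It is again of the form `x = x₀ cos ψ`. If `x₀ ≠ 0`, periodicity forces `n
H(a, x₀) = kπ` with `x₀` small, which is impossible unless `a` is a bifurcation instant. So `x = 0`
throughout, and the two angles supply the reparametrization. -/

/-- With `x = cos 2φ`, the derivative of the arclength is `π * radialSpeed a x`. -/
def radialSpeed (a x : ℝ) : ℝ := √((1 + x) * (a ^ 2 * (1 + x) + (1 - x)))

lemma radialSpeed_pos {a x : ℝ} (ha : 0 < a) (hx : x ∈ Ioo (-1 : ℝ) 1) : 0 < radialSpeed a x := by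
  have h1 : 0 < 1 + x := by linarith [hx.1]
  have h2 : 0 < 1 - x := by linarith [hx.2]
  exact Real.sqrt_pos.2 (by positivity)

lemma continuous_radialSpeed (a : ℝ) : Continuous (radialSpeed a) := by
  unfold radialSpeed; fun_prop

lemma radialSpeed_cos_two_mul {a φ : ℝ} (hφ : φ ∈ Ioo 0 (Real.pi / 2)) :
    2 * Real.pi * (Real.cos φ * √(a ^ 2 * Real.cos φ ^ 2 + Real.sin φ ^ 2)) =
      Real.pi * radialSpeed a (Real.cos (2 * φ)) := by
  have hc : 0 < Real.cos φ := Real.cos_pos_of_mem_Ioo ⟨by linarith [hφ.1, Real.pi_pos], hφ.2⟩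
  have : (1 + Real.cos (2 * φ)) * (a ^ 2 * (1 + Real.cos (2 * φ)) + (1 - Real.cos (2 * φ))) =
      (2 * Real.cos φ) ^ 2 * (a ^ 2 * Real.cos φ ^ 2 + Real.sin φ ^ 2) := by
    rw [Real.cos_two_mul]
    linear_combination (-4 * Real.cos φ ^ 2) * Real.sin_sq_add_cos_sq φ
  rw [radialSpeed, this, Real.sqrt_mul (by positivity), Real.sqrt_sq (by positivity)]
  ring

lemma cos_two_mul_mem {φ : ℝ} (hφ : φ ∈ Ioo 0 (Real.pi / 2)) :
    Real.cos (2 * φ) ∈ Ioo (-1 : ℝ) 1 := by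
  have hs : 0 < Real.sin φ := Real.sin_pos_of_pos_of_lt_pi hφ.1 (by linarith [hφ.2, Real.pi_pos])
  have hc : 0 < Real.cos φ := Real.cos_pos_of_mem_Ioo ⟨by linarith [hφ.1, Real.pi_pos], hφ.2⟩
  constructor
  · rw [Real.cos_two_mul]; nlinarith
  · rw [Real.cos_two_mul']; nlinarith [Real.sin_sq_add_cos_sq φ]

lemma hasStrictDerivAt_arclength (a φ : ℝ) : HasStrictDerivAt (arclength a)
    (2 * Real.pi * (Real.cos φ * √(a ^ 2 * Real.cos φ ^ 2 + Real.sin φ ^ 2))) φ := by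
  have hc : Continuous fun ξ : ℝ => Real.cos ξ * √(a ^ 2 * Real.cos ξ ^ 2 + Real.sin ξ ^ 2) := by
    fun_prop
  exact (hc.integral_hasStrictDerivAt 0 φ).const_mul (2 * Real.pi)

lemma hasStrictDerivAt_arclength' {a φ : ℝ} (hφ : φ ∈ Ioo 0 (Real.pi / 2)) :
    HasStrictDerivAt (arclength a) (Real.pi * radialSpeed a (Real.cos (2 * φ))) φ := by
  rw [← radialSpeed_cos_two_mul hφ]
  exact hasStrictDerivAt_arclength a φ

lemma continuous_arclength (a : ℝ) : Continuous (arclength a) :=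
  continuous_iff_continuousAt.2 fun φ => (hasStrictDerivAt_arclength a φ).hasDerivAt.continuousAt

lemma strictMonoOn_arclength {a : ℝ} (ha : 0 < a) :
    StrictMonoOn (arclength a) (Icc 0 (Real.pi / 2)) := by
  refine strictMonoOn_of_deriv_pos (convex_Icc _ _) (continuous_arclength a).continuousOn ?_
  intro φ hφ
  rw [interior_Icc] at hφ
  rw [(hasStrictDerivAt_arclength' hφ).hasDerivAt.deriv]
  exact mul_pos Real.pi_pos (radialSpeed_pos ha (cos_two_mul_mem hφ))

@[simp] lemma arclength_zero (a : ℝ) : arclength a 0 = 0 := by simp [arclength]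

lemma arclength_mem {a φ : ℝ} (ha : 0 < a) (hφ : φ ∈ Ioo 0 (Real.pi / 2)) :
    arclength a φ ∈ Ioo 0 (diskRadius a) := by
  have h := Real.pi_pos
  constructor
  · simpa using strictMonoOn_arclength ha ⟨le_rfl, by positivity⟩ ⟨hφ.1.le, hφ.2.le⟩ hφ.1
  · exact strictMonoOn_arclength ha ⟨hφ.1.le, hφ.2.le⟩ ⟨by positivity, le_rfl⟩ hφ.2

lemma polarAngle_arclength {a φ : ℝ} (ha : 0 < a) (hφ : φ ∈ Ioo 0 (Real.pi / 2)) :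
    polarAngle a (arclength a φ) = φ :=
  (strictMonoOn_arclength ha).injOn.leftInvOn_invFunOn ⟨hφ.1.le, hφ.2.le⟩

lemma exists_arclength_eq {a ρ : ℝ} (hρ : ρ ∈ Ioo 0 (diskRadius a)) :
    ∃ φ ∈ Ioo 0 (Real.pi / 2), arclength a φ = ρ := by
  have h := intermediate_value_Ioo (by positivity : (0 : ℝ) ≤ Real.pi / 2)
    (continuous_arclength a).continuousOn
  rw [arclength_zero] at h
  exact h hρ

lemma polarAngle_mem {a ρ : ℝ} (ha : 0 < a) (hρ : ρ ∈ Ioo 0 (diskRadius a)) :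
    polarAngle a ρ ∈ Ioo 0 (Real.pi / 2) := by
  obtain ⟨φ, hφ, rfl⟩ := exists_arclength_eq hρ
  rwa [polarAngle_arclength ha hφ]

lemma arclength_polarAngle {a ρ : ℝ} (ha : 0 < a) (hρ : ρ ∈ Ioo 0 (diskRadius a)) :
    arclength a (polarAngle a ρ) = ρ := by
  obtain ⟨φ, hφ, rfl⟩ := exists_arclength_eq hρ
  rw [polarAngle_arclength ha hφ]

/-- The coordinate `x = cos 2φ` on the orbit space, as a function of the radius. -/
def radialCos (a ρ : ℝ) : ℝ := Real.cos (2 * polarAngle a ρ)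

lemma radialCos_mem {a ρ : ℝ} (ha : 0 < a) (hρ : ρ ∈ Ioo 0 (diskRadius a)) :
    radialCos a ρ ∈ Ioo (-1 : ℝ) 1 := cos_two_mul_mem (polarAngle_mem ha hρ)

lemma hasDerivAt_polarAngle {a ρ : ℝ} (ha : 0 < a) (hρ : ρ ∈ Ioo 0 (diskRadius a)) :
    HasDerivAt (polarAngle a) (Real.pi * radialSpeed a (radialCos a ρ))⁻¹ ρ := by
  have hφ := polarAngle_mem ha hρ
  have hd := hasStrictDerivAt_arclength' (a := a) hφ
  have hne : Real.pi * radialSpeed a (Real.cos (2 * polarAngle a ρ)) ≠ 0 :=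
    (mul_pos Real.pi_pos (radialSpeed_pos ha (cos_two_mul_mem hφ))).ne'
  have h := hd.to_local_left_inverse (g := polarAngle a) hne ?_
  · rw [arclength_polarAngle ha hρ] at h
    exact h.hasDerivAt
  · filter_upwards [isOpen_Ioo.mem_nhds hφ] with y hy
    exact polarAngle_arclength ha hy

lemma sin_two_mul_polarAngle {a ρ : ℝ} (ha : 0 < a) (hρ : ρ ∈ Ioo 0 (diskRadius a)) :
    Real.sin (2 * polarAngle a ρ) = √(1 - radialCos a ρ ^ 2) := by
  have hφ := polarAngle_mem ha hρ
  rw [radialCos, ← Real.sin_sq, Real.sqrt_sq]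
  exact (Real.sin_pos_of_pos_of_lt_pi (by linarith [hφ.1]) (by linarith [hφ.2])).le

lemma hasDerivAt_radialCos {a ρ : ℝ} (ha : 0 < a) (hρ : ρ ∈ Ioo 0 (diskRadius a)) :
    HasDerivAt (radialCos a)
      (-2 * √(1 - radialCos a ρ ^ 2) / (Real.pi * radialSpeed a (radialCos a ρ))) ρ := by
  have h := ((hasDerivAt_polarAngle ha hρ).const_mul 2).cos
  rw [sin_two_mul_polarAngle ha hρ] at h
  refine h.congr_deriv ?_
  ring

/-- The radius as a function of `x = cos 2φ`. -/
def radiusOfCos (a x : ℝ) : ℝ := arclength a (Real.arccos x / 2)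

lemma half_arccos_mem {x : ℝ} (hx : x ∈ Ioo (-1 : ℝ) 1) :
    Real.arccos x / 2 ∈ Ioo 0 (Real.pi / 2) := by
  have h1 : 0 < Real.arccos x := Real.arccos_pos.2 hx.2
  have h2 : Real.arccos x < Real.pi := Real.arccos_lt_pi.2 hx.1
  constructor <;> linarith

lemma radiusOfCos_mem {a x : ℝ} (ha : 0 < a) (hx : x ∈ Ioo (-1 : ℝ) 1) :
    radiusOfCos a x ∈ Ioo 0 (diskRadius a) := arclength_mem ha (half_arccos_mem hx)

lemma radialCos_radiusOfCos {a x : ℝ} (ha : 0 < a) (hx : x ∈ Ioo (-1 : ℝ) 1) :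
    radialCos a (radiusOfCos a x) = x := by
  rw [radialCos, radiusOfCos, polarAngle_arclength ha (half_arccos_mem hx),
    mul_div_cancel₀ _ two_ne_zero, Real.cos_arccos hx.1.le hx.2.le]

lemma radiusOfCos_radialCos {a ρ : ℝ} (ha : 0 < a) (hρ : ρ ∈ Ioo 0 (diskRadius a)) :
    radiusOfCos a (radialCos a ρ) = ρ := by
  have hφ := polarAngle_mem ha hρ
  rw [radiusOfCos, radialCos, Real.arccos_cos (by linarith [hφ.1]) (by linarith [hφ.2]),
    mul_div_cancel_left₀ _ two_ne_zero, arclength_polarAngle ha hρ]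

lemma hasDerivAt_radiusOfCos {a x : ℝ} (hx : x ∈ Ioo (-1 : ℝ) 1) :
    HasDerivAt (radiusOfCos a) (-Real.pi * radialSpeed a x / (2 * √(1 - x ^ 2))) x := by
  have h := (hasStrictDerivAt_arclength' (a := a) (half_arccos_mem hx)).hasDerivAt.comp x
    ((Real.hasDerivAt_arccos hx.1.ne' hx.2.ne).div_const 2)
  rw [mul_div_cancel₀ _ two_ne_zero, Real.cos_arccos hx.1.le hx.2.le] at h
  refine h.congr_deriv ?_
  ring

/-! ### The metric in polar coordinates -/

/-- The radius is arclength for the weighted metric: `dρ/dφ` is `V` times the Euclidean length of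
the meridian velocity. The angular coefficient is `(2π cos φ · a sin φ)² = π² a² sin² 2φ`. -/
lemma orbitMetric_eq {a : ℝ} (ha : 0 < a) {p : ℝ × ℝ} (hp : p.1 ∈ Ioo 0 (diskRadius a))
    (v w : ℝ × ℝ) : orbitMetric a p v w =
      v.1 * w.1 + Real.pi ^ 2 * a ^ 2 * (1 - radialCos a p.1 ^ 2) * (v.2 * w.2) := by
  have hφ := polarAngle_mem ha hp
  have hpos : 0 < Real.pi * radialSpeed a (radialCos a p.1) :=
    mul_pos Real.pi_pos (radialSpeed_pos ha (radialCos_mem ha hp))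
  have hsp := radialSpeed_cos_two_mul (a := a) hφ
  have hA := ((hasDerivAt_polarAngle ha hp).hasFDerivAt.comp p hasFDerivAt_fst)
  have hS := (Real.hasDerivAt_sin (polarAngle a p.1)).hasFDerivAt.comp p hA
  have hC := (Real.hasDerivAt_cos (polarAngle a p.1)).hasFDerivAt.comp p hA
  have hC2 : HasFDerivAt (fun q : ℝ × ℝ => Real.cos q.2) _ p :=
    (Real.hasDerivAt_cos p.2).hasFDerivAt.comp p hasFDerivAt_snd
  have hS2 : HasFDerivAt (fun q : ℝ × ℝ => Real.sin q.2) _ p :=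
    (Real.hasDerivAt_sin p.2).hasFDerivAt.comp p hasFDerivAt_snd
  have h0 := (hC2.const_mul a).mul hS
  have h1 := (hS2.const_mul a).mul hS
  have hdiff : DifferentiableAt ℝ (orbitPoint a) p := by
    rw [differentiableAt_euclidean]
    intro i
    fin_cases i
    · exact h0.differentiableAt
    · exact h1.differentiableAt
    · exact hC.differentiableAt
  have hcomp : ∀ (i : Fin 3) (f' : ℝ × ℝ →L[ℝ] ℝ) (_ : HasFDerivAt (fun q => orbitPoint a q i) f' p)
      (u : ℝ × ℝ), fderiv ℝ (orbitPoint a) p u i = f' u := by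
    intro i f' hf u
    have := ((EuclideanSpace.proj i : EuclideanSpace ℝ (Fin 3) →L[ℝ] ℝ).hasFDerivAt.comp p
      hdiff.hasFDerivAt)
    rw [hf.unique this]
    rfl
  have e0 := hcomp 0 _ h0
  have e1 := hcomp 1 _ h1
  have e2 := hcomp 2 _ hC
  rw [orbitMetric, orbitVolume, PiLp.inner_apply, Fin.sum_univ_three]
  simp only [e0, e1, e2, RCLike.inner_apply, conj_trivial]
  have hr : orbitPoint a p 2 = Real.cos (polarAngle a p.1) := rfl
  rw [hr]
  simp only [Function.comp_apply, _root_.add_apply, _root_.smul_apply,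
    ContinuousLinearMap.comp_apply, ContinuousLinearMap.toSpanSingleton_apply,
    ContinuousLinearMap.coe_fst', ContinuousLinearMap.coe_snd', smul_eq_mul]
  have hx : radialCos a p.1 = Real.cos (2 * polarAngle a p.1) := rfl
  rw [← hx] at hsp
  set h := Real.pi * radialSpeed a (radialCos a p.1) with hh
  set φ := polarAngle a p.1
  have hE : 0 ≤ a ^ 2 * Real.cos φ ^ 2 + Real.sin φ ^ 2 := by positivity
  have hsq : h ^ 2 = 4 * Real.pi ^ 2 * Real.cos φ ^ 2 *
      (a ^ 2 * Real.cos φ ^ 2 + Real.sin φ ^ 2) := by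
    rw [← hsp, mul_pow, mul_pow _ (√ _), Real.sq_sqrt hE]; ring
  have hsin : 1 - radialCos a p.1 ^ 2 = 4 * Real.sin φ ^ 2 * Real.cos φ ^ 2 := by
    rw [hx, ← Real.sin_sq, Real.sin_two_mul]; ring
  rw [hsin]
  -- The derivatives of the coordinates carry the factor `h⁻¹ = dφ/dρ`. Inserting `h⁻² h²` and
  -- expanding only `h²` makes both sides comparable.
  have key : v.1 * w.1 = v.1 * w.1 * h⁻¹ ^ 2 * h ^ 2 := by
    field_simp
  rw [key, hsq]
  have hcs := Real.sin_sq_add_cos_sq p.2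
  have hc2 : Real.cos p.2 ^ 2 = 1 - Real.sin p.2 ^ 2 := by linarith
  ring_nf
  simp only [hc2]
  ring

/-! ### The geodesic equation in polar coordinates -/

/-- The Euler-Lagrange equation is linear in `e`, so two basis vectors suffice. The vector `(1, 0)`
gives the radial equation; `(0, 1)` gives conservation of angular momentum, because the metric does
not depend on `θ`. -/
lemma isGeodesic_iff {a : ℝ} (ha : 0 < a) (γ : ℝ → ℝ × ℝ) : IsGeodesic a γ ↔
    ContDiff ℝ 2 γ ∧ (∀ t, (γ t).1 ∈ Ioo 0 (diskRadius a)) ∧ ∀ t,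
      HasDerivAt (fun τ => (deriv γ τ).1)
        (2 * Real.pi * a ^ 2 * radialCos a (γ t).1 * √(1 - radialCos a (γ t).1 ^ 2) /
          radialSpeed a (radialCos a (γ t).1) * (deriv γ t).2 ^ 2) t ∧
      HasDerivAt (fun τ => (1 - radialCos a (γ τ).1 ^ 2) * (deriv γ τ).2) 0 t := by
  refine and_congr_right fun _ => and_congr_right fun hmem => forall_congr' fun t => ?_
  have hlhs : ∀ e : ℝ × ℝ, (fun τ => orbitMetric a (γ τ) (deriv γ τ) e) = fun τ =>
      (deriv γ τ).1 * e.1 +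
        Real.pi ^ 2 * a ^ 2 * (((1 - radialCos a (γ τ).1 ^ 2) * (deriv γ τ).2) * e.2) := by
    intro e
    funext τ
    rw [orbitMetric_eq ha (hmem τ)]
    ring
  have hrhs : ∀ e : ℝ × ℝ,
      fderiv ℝ (fun p => orbitMetric a p (deriv γ t) (deriv γ t)) (γ t) e =
        2 * (2 * Real.pi * a ^ 2 * radialCos a (γ t).1 * √(1 - radialCos a (γ t).1 ^ 2) /
          radialSpeed a (radialCos a (γ t).1) * (deriv γ t).2 ^ 2) * e.1 := by
    intro e
    have h1 := ((hasDerivAt_radialCos ha (hmem t)).pow 2).const_sub 1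
    have h2 := (h1.const_mul (Real.pi ^ 2 * a ^ 2 * (deriv γ t).2 ^ 2)).const_add ((deriv γ t).1 ^ 2)
    have h3 := h2.hasFDerivAt.comp (γ t) hasFDerivAt_fst
    have h4 : (fun p : ℝ × ℝ => orbitMetric a p (deriv γ t) (deriv γ t)) =ᶠ[𝓝 (γ t)]
        ((fun ρ : ℝ => (deriv γ t).1 ^ 2 + Real.pi ^ 2 * a ^ 2 * (deriv γ t).2 ^ 2 *
          (1 - (radialCos a ^ 2) ρ)) ∘ Prod.fst) := by
      filter_upwards [(isOpen_Ioo.preimage continuous_fst).mem_nhds (hmem t)] with p hp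
      rw [orbitMetric_eq ha hp]
      simp only [Function.comp_apply, Pi.pow_apply]
      ring
    rw [h4.fderiv_eq, h3.fderiv]
    have hs := (radialSpeed_pos ha (radialCos_mem ha (hmem t))).ne'
    have := Real.pi_ne_zero
    simp only [ContinuousLinearMap.comp_apply, ContinuousLinearMap.toSpanSingleton_apply,
      ContinuousLinearMap.coe_fst', smul_eq_mul]
    field_simp
    norm_num
  constructor
  · intro h
    constructor
    · have := h (1, 0)
      rw [hlhs, hrhs] at this
      refine (this.congr_of_eventuallyEq (.of_forall fun τ => ?_)).congr_deriv ?_ <;>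
      · simp
        try ring
    · have h01 := h (0, 1)
      rw [hlhs, hrhs] at h01
      have := h01.const_mul (Real.pi ^ 2 * a ^ 2)⁻¹
      have hpi := Real.pi_ne_zero
      refine (this.congr_of_eventuallyEq (.of_forall fun τ => ?_)).congr_deriv ?_
      · simp
        field_simp
      · simp
  · rintro ⟨h1, h2⟩ e
    rw [hlhs, hrhs]
    refine ((h1.mul_const e.1).add ((h2.mul_const e.2).const_mul _)).congr_deriv ?_
    ring

/-! ### Primitives of positive functions -/

/-- Along `cos` the integrand is bounded below by its positive minimum on `[-1, 1]`, so the
primitive grows at least linearly in both directions and is a bijection of `ℝ`. Applied to time this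
gives completeness of the geodesics; applied to the angle it shows that every angle is attained. -/
lemma exists_inverse_integral {h : ℝ → ℝ} (hc : Continuous h) (hpos : ∀ x ∈ Icc (-1 : ℝ) 1, 0 < h x) :
    ∃ g : ℝ → ℝ, (∀ t, ∫ ξ in (0 : ℝ)..g t, h (Real.cos ξ) = t) ∧
      (∀ ψ, g (∫ ξ in (0 : ℝ)..ψ, h (Real.cos ξ)) = ψ) ∧
      ∀ t, HasDerivAt g (h (Real.cos (g t)))⁻¹ t := by
  obtain ⟨x₁, hx₁, hmin⟩ := isCompact_Icc.exists_isMinOn (nonempty_Icc.2 (by norm_num : (-1 : ℝ) ≤ 1))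
    hc.continuousOn
  have hlow : ∀ ξ, h x₁ ≤ h (Real.cos ξ) := fun ξ => hmin ⟨Real.neg_one_le_cos ξ, Real.cos_le_one ξ⟩
  have hm := hpos x₁ hx₁
  have hcc : Continuous fun ξ => h (Real.cos ξ) := hc.comp Real.continuous_cos
  set F : ℝ → ℝ := fun ψ => ∫ ξ in (0 : ℝ)..ψ, h (Real.cos ξ) with hF
  have hd : ∀ ψ, HasDerivAt F (h (Real.cos ψ)) ψ := fun ψ =>
    (hcc.integral_hasStrictDerivAt 0 ψ).hasDerivAt
  have hcF : Continuous F := continuous_iff_continuousAt.2 fun ψ => (hd ψ).continuousAt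
  have hmono : StrictMono F := strictMono_of_deriv_pos fun ψ => by
    rw [(hd ψ).deriv]; exact hm.trans_le (hlow ψ)
  have hmono2 : Monotone fun ψ => F ψ - h x₁ * ψ :=
    monotone_of_deriv_nonneg
      (fun ψ => ((hd ψ).sub ((hasDerivAt_id ψ).const_mul (h x₁))).differentiableAt) fun ψ => by
      have := ((hd ψ).sub ((hasDerivAt_id ψ).const_mul (h x₁))).deriv
      simp only [mul_one] at this
      have h2 := hlow ψ
      have e : (fun ψ => F ψ - h x₁ * ψ) = F - fun y => h x₁ * id y := rfl
      rw [e, this]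
      linarith
  have hF0 : F 0 = 0 := by simp [hF]
  have htop : Tendsto F atTop atTop := by
    refine tendsto_atTop_mono' _ ?_ (tendsto_id.const_mul_atTop hm)
    filter_upwards [eventually_ge_atTop 0] with ψ hψ
    have := hmono2 hψ
    simp only [hF0] at this
    simp only [id]
    linarith
  have hbot : Tendsto F atBot atBot := by
    refine tendsto_atBot_mono' _ ?_ (tendsto_id.const_mul_atBot hm)
    filter_upwards [eventually_le_atBot 0] with ψ hψ
    have := hmono2 hψ
    simp only [hF0] at this
    simp only [id]
    linarith
  have hsurj : Function.Surjective F := hcF.surjective htop hbot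
  let e := hmono.orderIsoOfSurjective F hsurj
  have he : ∀ ψ, e ψ = F ψ := fun _ => rfl
  refine ⟨e.symm, fun t => ?_, fun ψ => ?_, fun t => ?_⟩
  · exact e.apply_symm_apply t
  · exact e.symm_apply_apply ψ
  · refine HasDerivAt.of_local_left_inverse e.symm.continuous.continuousAt (hd _)
      (hm.trans_le (hlow _)).ne' (.of_forall fun s => e.apply_symm_apply s)

/-! ### The phase of a geodesic -/

/-- The time at which the geodesic `cos 2φ = x₀ cos ψ` has phase `ψ`. -/
def phaseTime (a x₀ ψ : ℝ) : ℝ :=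
  ∫ ξ in (0 : ℝ)..ψ, radialSpeed a (x₀ * Real.cos ξ) / (2 * a * √(1 - x₀ ^ 2))

/-- The polar angle at which the geodesic `cos 2φ = x₀ cos ψ` has phase `ψ`. -/
def phaseAngle (a x₀ ψ : ℝ) : ℝ :=
  ∫ ξ in (0 : ℝ)..ψ,
    √(1 - x₀ ^ 2) * radialSpeed a (x₀ * Real.cos ξ) / (2 * a * (1 - (x₀ * Real.cos ξ) ^ 2))

lemma mul_mem_of_mem_Icc {x₀ y : ℝ} (hx₀ : x₀ ∈ Ioo (-1 : ℝ) 1) (hy : y ∈ Icc (-1 : ℝ) 1) :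
    x₀ * y ∈ Ioo (-1 : ℝ) 1 := by
  have h1 : |x₀| < 1 := abs_lt.2 hx₀
  have h2 : |y| ≤ 1 := abs_le.2 hy
  refine abs_lt.1 ?_
  rw [abs_mul]
  nlinarith [abs_nonneg x₀, abs_nonneg y]

lemma mul_cos_mem {x₀ : ℝ} (hx₀ : x₀ ∈ Ioo (-1 : ℝ) 1) (ψ : ℝ) :
    x₀ * Real.cos ψ ∈ Ioo (-1 : ℝ) 1 :=
  mul_mem_of_mem_Icc hx₀ ⟨Real.neg_one_le_cos ψ, Real.cos_le_one ψ⟩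

lemma one_sub_sq_pos {x : ℝ} (hx : x ∈ Ioo (-1 : ℝ) 1) : 0 < 1 - x ^ 2 := by
  nlinarith [hx.1, hx.2]

lemma exists_phase {a x₀ : ℝ} (ha : 0 < a) (hx₀ : x₀ ∈ Ioo (-1 : ℝ) 1) :
    ∃ g : ℝ → ℝ, (∀ t, phaseTime a x₀ (g t) = t) ∧ (∀ ψ, g (phaseTime a x₀ ψ) = ψ) ∧
      ∀ t, HasDerivAt g (2 * a * √(1 - x₀ ^ 2) / radialSpeed a (x₀ * Real.cos (g t))) t := by
  have hq : 0 < √(1 - x₀ ^ 2) := Real.sqrt_pos.2 (one_sub_sq_pos hx₀)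
  obtain ⟨g, h1, h2, h3⟩ := exists_inverse_integral
    (h := fun y => radialSpeed a (x₀ * y) / (2 * a * √(1 - x₀ ^ 2)))
    (by have := continuous_radialSpeed a; fun_prop)
    (fun y hy => div_pos (radialSpeed_pos ha (mul_mem_of_mem_Icc hx₀ hy)) (by positivity))
  exact ⟨g, h1, h2, fun t => (h3 t).congr_deriv (inv_div _ _)⟩

/-- The phase at a given time: the inverse function of `phaseTime`. -/
def phase (a x₀ : ℝ) : ℝ → ℝ := Function.invFun (phaseTime a x₀)

lemma phase_spec {a x₀ : ℝ} (ha : 0 < a) (hx₀ : x₀ ∈ Ioo (-1 : ℝ) 1) :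
    (∀ t, phaseTime a x₀ (phase a x₀ t) = t) ∧ (∀ ψ, phase a x₀ (phaseTime a x₀ ψ) = ψ) ∧
      ∀ t, HasDerivAt (phase a x₀)
        (2 * a * √(1 - x₀ ^ 2) / radialSpeed a (x₀ * Real.cos (phase a x₀ t))) t := by
  obtain ⟨g, h1, h2, h3⟩ := exists_phase ha hx₀
  have hinj : Function.Injective (phaseTime a x₀) := Function.LeftInverse.injective h2
  have : phase a x₀ = g := by
    funext t
    have := Function.leftInverse_invFun hinj (g t)
    rwa [h1] at this
  rw [this]
  exact ⟨h1, h2, h3⟩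

lemma hasDerivAt_phaseTime {a x₀ : ℝ} (ψ : ℝ) : HasDerivAt (phaseTime a x₀)
    (radialSpeed a (x₀ * Real.cos ψ) / (2 * a * √(1 - x₀ ^ 2))) ψ := by
  have := continuous_radialSpeed a
  have hc : Continuous fun ξ => radialSpeed a (x₀ * Real.cos ξ) / (2 * a * √(1 - x₀ ^ 2)) := by
    fun_prop
  exact (hc.integral_hasStrictDerivAt 0 ψ).hasDerivAt

lemma hasDerivAt_phaseAngle {a x₀ : ℝ} (ha : 0 < a) (hx₀ : x₀ ∈ Ioo (-1 : ℝ) 1) (ψ : ℝ) :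
    HasDerivAt (phaseAngle a x₀) (√(1 - x₀ ^ 2) * radialSpeed a (x₀ * Real.cos ψ) /
      (2 * a * (1 - (x₀ * Real.cos ψ) ^ 2))) ψ := by
  have := continuous_radialSpeed a
  have hne : ∀ ξ, 2 * a * (1 - (x₀ * Real.cos ξ) ^ 2) ≠ 0 := fun ξ =>
    (mul_pos (by positivity) (one_sub_sq_pos (mul_cos_mem hx₀ ξ))).ne'
  have hc : Continuous fun ξ => √(1 - x₀ ^ 2) * radialSpeed a (x₀ * Real.cos ξ) /
      (2 * a * (1 - (x₀ * Real.cos ξ) ^ 2)) :=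
    Continuous.div (by fun_prop) (by fun_prop) hne
  exact (hc.integral_hasStrictDerivAt 0 ψ).hasDerivAt

@[simp] lemma phaseTime_zero (a x₀ : ℝ) : phaseTime a x₀ 0 = 0 := by simp [phaseTime]

@[simp] lemma phaseAngle_zero (a x₀ : ℝ) : phaseAngle a x₀ 0 = 0 := by simp [phaseAngle]

lemma phase_zero {a x₀ : ℝ} (ha : 0 < a) (hx₀ : x₀ ∈ Ioo (-1 : ℝ) 1) : phase a x₀ 0 = 0 := by
  simpa using (phase_spec ha hx₀).2.1 0

/-- A solution of `x' = -ν D`, `D' = ν x` rotates with angular velocity `ν`. -/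
lemma eq_rotation {x D ν ψ : ℝ → ℝ} {t₀ : ℝ} (hx : ∀ t, HasDerivAt x (-(ν t * D t)) t)
    (hD : ∀ t, HasDerivAt D (ν t * x t) t) (hψ : ∀ t, HasDerivAt ψ (ν t) t)
    (hψ₀ : ψ t₀ = 0) (hD₀ : D t₀ = 0) (t : ℝ) :
    x t = x t₀ * Real.cos (ψ t) ∧ D t = x t₀ * Real.sin (ψ t) := by
  -- Rotating `(x, D)` back by the angle `ψ` gives a constant vector; `h1` and `h2` are its two
  -- components.
  have h1 : ∀ t, HasDerivAt (fun t => x t * Real.cos (ψ t) + D t * Real.sin (ψ t)) 0 t := fun t =>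
    (((hx t).mul (hψ t).cos).add ((hD t).mul (hψ t).sin)).congr_deriv (by ring)
  have h2 : ∀ t, HasDerivAt (fun t => D t * Real.cos (ψ t) - x t * Real.sin (ψ t)) 0 t := fun t =>
    (((hD t).mul (hψ t).cos).sub ((hx t).mul (hψ t).sin)).congr_deriv (by ring)
  have e1 := is_const_of_deriv_eq_zero (fun t => (h1 t).differentiableAt) (fun t => (h1 t).deriv) t t₀
  have e2 := is_const_of_deriv_eq_zero (fun t => (h2 t).differentiableAt) (fun t => (h2 t).deriv) t t₀
  simp only [hψ₀, hD₀, Real.cos_zero, Real.sin_zero, mul_one, mul_zero, add_zero,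
    sub_zero] at e1 e2
  have hcs := Real.sin_sq_add_cos_sq (ψ t)
  constructor
  · linear_combination Real.cos (ψ t) * e1 - Real.sin (ψ t) * e2 - x t * hcs
  · linear_combination Real.sin (ψ t) * e1 + Real.cos (ψ t) * e2 - D t * hcs

/-! ### The geodesics that start orthogonally to a radial segment -/

/-- The geodesic `cos 2φ = x₀ cos ψ`, parametrized by time. -/
def modelGeodesic (a x₀ t : ℝ) : ℝ × ℝ :=
  (radiusOfCos a (x₀ * Real.cos (phase a x₀ t)), phaseAngle a x₀ (phase a x₀ t))

lemma hasDerivAt_modelGeodesic {a x₀ : ℝ} (ha : 0 < a) (hx₀ : x₀ ∈ Ioo (-1 : ℝ) 1) (t : ℝ) :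
    HasDerivAt (modelGeodesic a x₀)
      (Real.pi * a * √(1 - x₀ ^ 2) * (x₀ * Real.sin (phase a x₀ t)) /
          √(1 - (x₀ * Real.cos (phase a x₀ t)) ^ 2),
        (1 - x₀ ^ 2) / (1 - (x₀ * Real.cos (phase a x₀ t)) ^ 2)) t := by
  have hψ := (phase_spec ha hx₀).2.2 t
  have hx := mul_cos_mem hx₀ (phase a x₀ t)
  have h1 := (hasDerivAt_radiusOfCos (a := a) hx).comp t (hψ.cos.const_mul x₀)
  have h2 := (hasDerivAt_phaseAngle ha hx₀ (phase a x₀ t)).comp t hψ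
  have hs := (radialSpeed_pos ha hx).ne'
  have hw := (Real.sqrt_pos.2 (one_sub_sq_pos hx)).ne'
  have hq2 := Real.sq_sqrt (one_sub_sq_pos hx₀).le
  have hne := (one_sub_sq_pos hx).ne'
  refine (h1.prodMk h2).congr_deriv (Prod.ext ?_ ?_)
  · simp only
    field_simp
  · simp only
    field_simp
    rw [hq2]

lemma deriv_modelGeodesic {a x₀ : ℝ} (ha : 0 < a) (hx₀ : x₀ ∈ Ioo (-1 : ℝ) 1) :
    deriv (modelGeodesic a x₀) = fun t =>
      (Real.pi * a * √(1 - x₀ ^ 2) * (x₀ * Real.sin (phase a x₀ t)) /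
          √(1 - (x₀ * Real.cos (phase a x₀ t)) ^ 2),
        (1 - x₀ ^ 2) / (1 - (x₀ * Real.cos (phase a x₀ t)) ^ 2)) :=
  funext fun t => (hasDerivAt_modelGeodesic ha hx₀ t).deriv

lemma contDiff_phase {a x₀ : ℝ} (ha : 0 < a) (hx₀ : x₀ ∈ Ioo (-1 : ℝ) 1) :
    ContDiff ℝ 1 (phase a x₀) := by
  have hψ := (phase_spec ha hx₀).2.2
  rw [contDiff_one_iff_deriv]
  refine ⟨fun t => (hψ t).differentiableAt, ?_⟩
  have hc : Continuous (phase a x₀) := continuous_iff_continuousAt.2 fun t => (hψ t).continuousAt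
  have := continuous_radialSpeed a
  rw [funext fun t => (hψ t).deriv]
  exact Continuous.div (by fun_prop) (by fun_prop)
    fun t => (radialSpeed_pos ha (mul_cos_mem hx₀ _)).ne'

lemma contDiff_modelGeodesic {a x₀ : ℝ} (ha : 0 < a) (hx₀ : x₀ ∈ Ioo (-1 : ℝ) 1) :
    ContDiff ℝ 2 (modelGeodesic a x₀) := by
  have h2 : (2 : WithTop ℕ∞) = 1 + 1 := by norm_num
  rw [h2, contDiff_succ_iff_deriv]
  refine ⟨fun t => (hasDerivAt_modelGeodesic ha hx₀ t).differentiableAt, by simp, ?_⟩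
  rw [deriv_modelGeodesic ha hx₀]
  have hψ := contDiff_phase ha hx₀
  have hpos : ∀ t, 0 < 1 - (x₀ * Real.cos (phase a x₀ t)) ^ 2 := fun t =>
    one_sub_sq_pos (mul_cos_mem hx₀ _)
  have hcos : ContDiff ℝ 1 fun t => Real.cos (phase a x₀ t) := Real.contDiff_cos.comp hψ
  have hsin : ContDiff ℝ 1 fun t => Real.sin (phase a x₀ t) := Real.contDiff_sin.comp hψ
  have hden : ContDiff ℝ 1 fun t => 1 - (x₀ * Real.cos (phase a x₀ t)) ^ 2 :=
    contDiff_const.sub ((contDiff_const.mul hcos).pow 2)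
  refine ContDiff.prodMk ?_ ?_
  · exact (contDiff_const.mul (contDiff_const.mul hsin)).div (hden.sqrt fun t => (hpos t).ne')
      fun t => (Real.sqrt_pos.2 (hpos t)).ne'
  · exact contDiff_const.div hden fun t => (hpos t).ne'

lemma isGeodesic_modelGeodesic {a x₀ : ℝ} (ha : 0 < a) (hx₀ : x₀ ∈ Ioo (-1 : ℝ) 1) :
    IsGeodesic a (modelGeodesic a x₀) := by
  refine (isGeodesic_iff ha _).2 ⟨contDiff_modelGeodesic ha hx₀,
    fun t => radiusOfCos_mem ha (mul_cos_mem hx₀ _), fun t => ?_⟩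
  have hcos : ∀ t, radialCos a (modelGeodesic a x₀ t).1 = x₀ * Real.cos (phase a x₀ t) :=
    fun t => radialCos_radiusOfCos ha (mul_cos_mem hx₀ _)
  have hx := mul_cos_mem hx₀ (phase a x₀ t)
  have hpos := one_sub_sq_pos hx
  simp only [hcos, deriv_modelGeodesic ha hx₀]
  have hψ := (phase_spec ha hx₀).2.2 t
  constructor
  · have hw := Real.sqrt_pos.2 hpos
    have hw2 := Real.sq_sqrt hpos.le
    have hq2 := Real.sq_sqrt (one_sub_sq_pos hx₀).le
    have hs := (radialSpeed_pos ha hx).ne'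
    have h1 := (hψ.sin.const_mul x₀).const_mul (Real.pi * a * √(1 - x₀ ^ 2))
    have h2 := (((hψ.cos.const_mul x₀).pow 2).const_sub 1).sqrt hpos.ne'
    refine (h1.div h2 hw.ne').congr_deriv ?_
    simp only [Pi.pow_apply]
    have hcs := Real.sin_sq_add_cos_sq (phase a x₀ t)
    set w := √(1 - (x₀ * Real.cos (phase a x₀ t)) ^ 2)
    set q := √(1 - x₀ ^ 2)
    set C := Real.cos (phase a x₀ t)
    set S := Real.sin (phase a x₀ t)
    set v := radialSpeed a (x₀ * C)
    rw [← hw2, ← hq2]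
    have hS : S ^ 2 = 1 - C ^ 2 := by linarith
    field_simp
    norm_num
    have e : w ^ 2 - x₀ ^ 2 * S ^ 2 = -(x₀ ^ 2 - 1) := by rw [hw2, hS]; ring
    have e' : q ^ 2 = 1 - x₀ ^ 2 := hq2
    linear_combination 2 * q ^ 2 * x₀ * C * (e - e')
  · have : (fun τ => (1 - (x₀ * Real.cos (phase a x₀ τ)) ^ 2) *
        ((1 - x₀ ^ 2) / (1 - (x₀ * Real.cos (phase a x₀ τ)) ^ 2))) = fun _ => 1 - x₀ ^ 2 :=
      funext fun τ => mul_div_cancel₀ _ (one_sub_sq_pos (mul_cos_mem hx₀ _)).ne'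
    rw [this]
    exact hasDerivAt_const _ _

/-- Uniqueness follows from the conservation laws rather than from a general theorem on differential
equations: they turn the radial equation into a rotation, whose solution is explicit. -/
lemma IsGeodesic.eq_modelGeodesic {a ρ₀ : ℝ} (ha : 0 < a) {γ : ℝ → ℝ × ℝ} (hγ : IsGeodesic a γ)
    (h0 : γ 0 = (ρ₀, 0)) (h0' : deriv γ 0 = (0, 1)) :
    γ = modelGeodesic a (radialCos a ρ₀) := by
  obtain ⟨hsm, hmem, hode⟩ := (isGeodesic_iff ha γ).1 hγ
  have hρ₀ : ρ₀ ∈ Ioo 0 (diskRadius a) := by simpa [h0] using hmem 0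
  set x₀ := radialCos a ρ₀ with hx₀def
  have hx₀ : x₀ ∈ Ioo (-1 : ℝ) 1 := radialCos_mem ha hρ₀
  have hq := Real.sqrt_pos.2 (one_sub_sq_pos hx₀)
  have hq2 := Real.sq_sqrt (one_sub_sq_pos hx₀).le
  set q := √(1 - x₀ ^ 2)
  have hpi := Real.pi_pos
  set x : ℝ → ℝ := fun t => radialCos a (γ t).1 with hx
  have hxmem : ∀ t, x t ∈ Ioo (-1 : ℝ) 1 := fun t => radialCos_mem ha (hmem t)
  have hx0 : x 0 = x₀ := by simp only [hx, h0, hx₀def]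
  have hpos : ∀ t, 0 < 1 - x t ^ 2 := fun t => one_sub_sq_pos (hxmem t)
  have hs : ∀ t, 0 < radialSpeed a (x t) := fun t => radialSpeed_pos ha (hxmem t)
  have hd : ∀ t, HasDerivAt γ (deriv γ t) t := fun t =>
    (hsm.differentiable (by norm_num) t).hasDerivAt
  have hd1 : ∀ t, HasDerivAt (fun τ => (γ τ).1) (deriv γ t).1 t := fun t =>
    (ContinuousLinearMap.fst ℝ ℝ ℝ).hasFDerivAt.comp_hasDerivAt t (hd t)
  have hd2 : ∀ t, HasDerivAt (fun τ => (γ τ).2) (deriv γ t).2 t := fun t =>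
    (ContinuousLinearMap.snd ℝ ℝ ℝ).hasFDerivAt.comp_hasDerivAt t (hd t)
  have hmom : ∀ t, (deriv γ t).2 = (1 - x₀ ^ 2) / (1 - x t ^ 2) := by
    intro t
    have := is_const_of_deriv_eq_zero (fun t => (hode t).2.differentiableAt)
      (fun t => (hode t).2.deriv) t 0
    rw [eq_div_iff (hpos t).ne', mul_comm, this, h0', h0]
    simp [hx₀def]
  have hxd : ∀ t, HasDerivAt x
      (-2 * √(1 - x t ^ 2) / (Real.pi * radialSpeed a (x t)) * (deriv γ t).1) t := fun t =>
    HasDerivAt.comp (h₂ := radialCos a) (h := fun τ => (γ τ).1) t (hasDerivAt_radialCos ha (hmem t))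
      (hd1 t)
  have hacc : ∀ t, HasDerivAt (fun τ => (deriv γ τ).1)
      (2 * Real.pi * a ^ 2 * x t * √(1 - x t ^ 2) / radialSpeed a (x t) *
        ((1 - x₀ ^ 2) / (1 - x t ^ 2)) ^ 2) t := fun t => by
    have := (hode t).1
    rwa [hmom t] at this
  -- Conservation of energy, with `θ̇` eliminated by the angular momentum. The constant is the value
  -- at `t = 0`, where `ρ̇ = 0`.
  have henergy : ∀ t, (deriv γ t).1 ^ 2 + Real.pi ^ 2 * a ^ 2 * (1 - x₀ ^ 2) ^ 2 / (1 - x t ^ 2) =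
      Real.pi ^ 2 * a ^ 2 * (1 - x₀ ^ 2) := by
    have h : ∀ t, HasDerivAt (fun τ => (deriv γ τ).1 ^ 2 +
        Real.pi ^ 2 * a ^ 2 * (1 - x₀ ^ 2) ^ 2 / (1 - x τ ^ 2)) 0 t := by
      intro t
      refine (((hacc t).pow 2).add ((hasDerivAt_const t (Real.pi ^ 2 * a ^ 2 * (1 - x₀ ^ 2) ^ 2)).div
        (((hxd t).pow 2).const_sub 1) (hpos t).ne')).congr_deriv ?_
      have := (hs t).ne'
      have := (hpos t).ne'
      simp only [Pi.pow_apply]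
      norm_num
      field_simp
      ring
    intro t
    have := is_const_of_deriv_eq_zero (fun t => (h t).differentiableAt) (fun t => (h t).deriv) t 0
    rw [this, h0', hx0]
    have := (one_sub_sq_pos hx₀).ne'
    field_simp
    ring
  set W : ℝ → ℝ := fun t => 2 * a * q / radialSpeed a (x t) with hW
  -- The scaling makes the energy identity read `x² + D² = x₀²`.
  set D : ℝ → ℝ := fun t => (deriv γ t).1 * √(1 - x t ^ 2) / (Real.pi * a * q) with hD
  have hxW : ∀ t, HasDerivAt x (-(W t * D t)) t := by
    intro t
    refine (hxd t).congr_deriv ?_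
    have := (hs t).ne'
    simp only [hW, hD]
    field_simp
  have hDW : ∀ t, HasDerivAt D (W t * x t) t := by
    intro t
    have hw := Real.sqrt_pos.2 (hpos t)
    have hw2 := Real.sq_sqrt (hpos t).le
    refine (((hacc t).mul ((((hxd t).pow 2).const_sub 1).sqrt (hpos t).ne')).div_const
      (Real.pi * a * q)).congr_deriv ?_
    have h1 := (hs t).ne'
    simp only [hW, Pi.pow_apply]
    norm_num
    have he := henergy t
    rw [← hw2] at he ⊢
    rw [Real.sqrt_sq hw.le]
    set w := √(1 - x t ^ 2)
    field_simp at he ⊢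
    rw [← hq2] at he ⊢
    linear_combination x t * he
  have hspc := continuous_radialSpeed a
  have hxc : Continuous x := continuous_iff_continuousAt.2 fun t => (hxd t).continuousAt
  have hWc : Continuous W := Continuous.div (by fun_prop) (by fun_prop) fun t => (hs t).ne'
  set ψ : ℝ → ℝ := fun t => ∫ ξ in (0 : ℝ)..t, W ξ with hψdef
  have hψ : ∀ t, HasDerivAt ψ (W t) t := fun t => (hWc.integral_hasStrictDerivAt 0 t).hasDerivAt
  have hψ0 : ψ 0 = 0 := by simp [hψdef]
  have hrot := fun t => (eq_rotation hxW hDW hψ hψ0 (by simp [hD, h0']) t).1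
  rw [hx0] at hrot
  -- The rotation angle `ψ` inverts `phaseTime`, hence it is the phase of the model geodesic.
  have htime : ∀ t, phaseTime a x₀ (ψ t) = t := by
    have h : ∀ t, HasDerivAt (fun t => phaseTime a x₀ (ψ t) - t) 0 t := by
      intro t
      refine (((hasDerivAt_phaseTime (ψ t)).comp t (hψ t)).sub (hasDerivAt_id t)).congr_deriv ?_
      have := (hs t).ne'
      rw [← hrot t, show √(1 - x₀ ^ 2) = q from rfl]
      simp only [hW]
      field_simp
      ring
    intro t
    have := is_const_of_deriv_eq_zero (fun t => (h t).differentiableAt) (fun t => (h t).deriv) t 0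
    simp only [hψ0, phaseTime_zero] at this
    linarith
  have hphase : ∀ t, phase a x₀ t = ψ t := fun t => by
    conv_lhs => rw [← htime t]
    exact (phase_spec ha hx₀).2.1 _
  have hmodel := fun t => (hasFDerivAt_snd.comp_hasDerivAt t (hasDerivAt_modelGeodesic ha hx₀ t))
  funext t
  refine Prod.ext ?_ ?_
  · rw [modelGeodesic, hphase, ← hrot, radiusOfCos_radialCos ha (hmem t)]
  · have h : ∀ t, HasDerivAt (fun t => (γ t).2 - (modelGeodesic a x₀ t).2) 0 t := by
      intro t
      refine ((hd2 t).sub (hmodel t)).congr_deriv ?_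
      rw [hmom t, hrot t, hphase t]
      simp
    have := is_const_of_deriv_eq_zero (fun t => (h t).differentiableAt) (fun t => (h t).deriv) t 0
    simp only [h0, modelGeodesic, phase_zero ha hx₀, phaseAngle_zero] at this
    exact sub_eq_zero.1 (this.trans (sub_zero 0))

/-! ### Orthogonal geodesics and the function `f_k` -/

variable {β : ℝ → ℝ → ℝ}

/-- The value of `cos 2φ` at the starting point of `γ_{a,s}`. -/
def initialCos (β : ℝ → ℝ → ℝ) (a s : ℝ) : ℝ := radialCos a (β a s)

lemma initialCos_mem (hβ : IsRadialParametrization β) {a s : ℝ} (h : (a, s) ∈ strip) :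
    initialCos β a s ∈ Ioo (-1 : ℝ) 1 := radialCos_mem h.1 (hβ.mem_Ioo a s h)

lemma isOrthogonalGeodesic_modelGeodesic (hβ : IsRadialParametrization β) {a s : ℝ}
    (h : (a, s) ∈ strip) : IsOrthogonalGeodesic β a s (modelGeodesic a (initialCos β a s)) := by
  have ha : 0 < a := h.1
  have hx₀ := initialCos_mem hβ h
  refine ⟨isGeodesic_modelGeodesic ha hx₀, ?_, ?_⟩
  · rw [modelGeodesic, phase_zero ha hx₀, Real.cos_zero, mul_one, phaseAngle_zero, initialCos,
      radiusOfCos_radialCos ha (hβ.mem_Ioo a s h)]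
  · rw [deriv_modelGeodesic ha hx₀]
    simp [phase_zero ha hx₀, div_self (one_sub_sq_pos hx₀).ne']

lemma IsOrthogonalGeodesic.eq_modelGeodesic {a s : ℝ} (ha : 0 < a) {γ : ℝ → ℝ × ℝ}
    (hγ : IsOrthogonalGeodesic β a s γ) : γ = modelGeodesic a (initialCos β a s) :=
  hγ.1.eq_modelGeodesic ha hγ.2.1 hγ.2.2

lemma existsUnique_isOrthogonalGeodesic (hβ : IsRadialParametrization β) {a s : ℝ}
    (h : (a, s) ∈ strip) : ∃! γ, IsOrthogonalGeodesic β a s γ :=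
  ⟨_, isOrthogonalGeodesic_modelGeodesic hβ h, fun _ hγ => hγ.eq_modelGeodesic h.1⟩

lemma orthGeodesic_eq (hβ : IsRadialParametrization β) {a s : ℝ} (h : (a, s) ∈ strip) :
    orthGeodesic β a s = modelGeodesic a (initialCos β a s) :=
  (Classical.epsilon_spec ⟨_, isOrthogonalGeodesic_modelGeodesic hβ h⟩ :
    IsOrthogonalGeodesic β a s (orthGeodesic β a s)).eq_modelGeodesic h.1

lemma exists_phaseAngle_eq {a x₀ : ℝ} (ha : 0 < a) (hx₀ : x₀ ∈ Ioo (-1 : ℝ) 1) (θ : ℝ) :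
    ∃ ψ, phaseAngle a x₀ ψ = θ := by
  have hq : 0 < √(1 - x₀ ^ 2) := Real.sqrt_pos.2 (one_sub_sq_pos hx₀)
  have hm := fun y hy => mul_mem_of_mem_Icc hx₀ (y := y) hy
  -- The integrand is singular at `x₀ y = ±1`. Truncating `y` to `[-1, 1]` makes it continuous on
  -- `ℝ` and changes nothing at `y = cos ξ`.
  have hden : ∀ y, 0 < 1 - (max (-1) (min y 1) * x₀) ^ 2 := fun y => by
    rw [mul_comm]
    exact one_sub_sq_pos (hm _ ⟨le_max_left _ _, max_le (by norm_num) (min_le_right _ _)⟩)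
  obtain ⟨g, h1, -, -⟩ := exists_inverse_integral
    (h := fun y => √(1 - x₀ ^ 2) * radialSpeed a (x₀ * y) /
      (2 * a * (1 - (max (-1) (min y 1) * x₀) ^ 2)))
    (by
      have := continuous_radialSpeed a
      exact Continuous.div (by fun_prop) (by fun_prop)
        fun y => (mul_pos (by positivity) (hden y)).ne')
    (fun y hy => div_pos (mul_pos hq (radialSpeed_pos ha (hm y hy)))
      (mul_pos (by positivity) (hden y)))
  refine ⟨g θ, ?_⟩
  refine Eq.trans ?_ (h1 θ)
  rw [phaseAngle]
  congr 1
  funext ξ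
  rw [min_eq_left (Real.cos_le_one ξ), max_eq_right (Real.neg_one_le_cos ξ), mul_comm x₀]

lemma strictMono_phaseAngle {a x₀ : ℝ} (ha : 0 < a) (hx₀ : x₀ ∈ Ioo (-1 : ℝ) 1) :
    StrictMono (phaseAngle a x₀) := by
  refine strictMono_of_deriv_pos fun ψ => ?_
  have hx := mul_cos_mem hx₀ ψ
  have h1 := one_sub_sq_pos hx
  have h2 := Real.sqrt_pos.2 (one_sub_sq_pos hx₀)
  have h3 := radialSpeed_pos ha hx
  rw [(hasDerivAt_phaseAngle ha hx₀ ψ).deriv]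
  positivity

/-- The angle between consecutive critical points of the radius along the geodesic
`cos 2φ = x₀ cos ψ`. -/
def halfPeriod (a x₀ : ℝ) : ℝ := phaseAngle a x₀ Real.pi

lemma halfPeriod_pos {a x₀ : ℝ} (ha : 0 < a) (hx₀ : x₀ ∈ Ioo (-1 : ℝ) 1) : 0 < halfPeriod a x₀ := by
  have := strictMono_phaseAngle ha hx₀ Real.pi_pos
  rwa [phaseAngle_zero] at this

/-- The integrand depends on `cos ξ` only. Its period `2π` makes the increment constant, and its
symmetry under `ξ ↦ 2π - ξ` makes the increment twice the integral over `[0, π]`. -/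
lemma phaseAngle_add_two_pi {a x₀ : ℝ} (ha : 0 < a) (hx₀ : x₀ ∈ Ioo (-1 : ℝ) 1) (ψ : ℝ) :
    phaseAngle a x₀ (ψ + 2 * Real.pi) = phaseAngle a x₀ ψ + 2 * halfPeriod a x₀ := by
  have h1 : ∀ ψ, HasDerivAt (fun ψ => phaseAngle a x₀ ψ + phaseAngle a x₀ (2 * Real.pi - ψ)) 0 ψ := by
    intro ψ
    refine ((hasDerivAt_phaseAngle ha hx₀ ψ).add ((hasDerivAt_phaseAngle ha hx₀ _).comp ψ
      ((hasDerivAt_id ψ).const_sub (2 * Real.pi)))).congr_deriv ?_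
    simp only [id, Real.cos_two_pi_sub]
    ring
  have h2 : ∀ ψ, HasDerivAt (fun ψ => phaseAngle a x₀ (ψ + 2 * Real.pi) - phaseAngle a x₀ ψ) 0 ψ := by
    intro ψ
    refine (((hasDerivAt_phaseAngle ha hx₀ _).comp ψ
      ((hasDerivAt_id ψ).add_const (2 * Real.pi))).sub (hasDerivAt_phaseAngle ha hx₀ ψ)).congr_deriv ?_
    simp only [id, Real.cos_add_two_pi]
    ring
  have e1 := is_const_of_deriv_eq_zero (fun t => (h1 t).differentiableAt) (fun t => (h1 t).deriv)
    0 Real.pi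
  have e2 := is_const_of_deriv_eq_zero (fun t => (h2 t).differentiableAt) (fun t => (h2 t).deriv)
    ψ 0
  have e3 : 2 * Real.pi - Real.pi = Real.pi := by ring
  simp only [e3, phaseAngle_zero, sub_zero, zero_add] at e1 e2
  rw [halfPeriod]
  linarith

/-- The integrand has period `2π` but in general not `π`, so the recursion goes in steps of two from
two base cases. -/
lemma phaseAngle_nat_mul_pi {a x₀ : ℝ} (ha : 0 < a) (hx₀ : x₀ ∈ Ioo (-1 : ℝ) 1) :
    ∀ m : ℕ, phaseAngle a x₀ (m * Real.pi) = m * halfPeriod a x₀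
  | 0 => by simp
  | 1 => by simp [halfPeriod]
  | m + 2 => by
    have e : ((m + 2 : ℕ) : ℝ) * Real.pi = m * Real.pi + 2 * Real.pi := by push_cast; ring
    rw [e, phaseAngle_add_two_pi ha hx₀, phaseAngle_nat_mul_pi ha hx₀ m]
    push_cast
    ring

/-- At a positive phase, `sin ψ` vanishes exactly when the angle is a multiple of the
half period. -/
lemma sin_eq_zero_iff_phaseAngle {a x₀ ψ θ : ℝ} (ha : 0 < a) (hx₀ : x₀ ∈ Ioo (-1 : ℝ) 1)
    (hθ : 0 < θ) (h : phaseAngle a x₀ ψ = θ) :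
    Real.sin ψ = 0 ↔ ∃ m : ℕ, 0 < m ∧ m * halfPeriod a x₀ = θ := by
  have hmono := strictMono_phaseAngle ha hx₀
  constructor
  · intro hs
    obtain ⟨n, hn⟩ := Real.sin_eq_zero_iff.1 hs
    have hψ : 0 < ψ := by
      rw [← hmono.lt_iff_lt, phaseAngle_zero, h]; exact hθ
    have hn0 : 0 < n := by
      have : (0 : ℝ) < n := by
        by_contra hc
        have := mul_nonpos_of_nonpos_of_nonneg (not_lt.1 hc) Real.pi_pos.le
        linarith
      exact_mod_cast this
    lift n to ℕ using hn0.le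
    refine ⟨n, by exact_mod_cast hn0, ?_⟩
    rw [← phaseAngle_nat_mul_pi ha hx₀, ← h, ← hn]
    simp
  · rintro ⟨m, -, hm⟩
    have : ψ = m * Real.pi := hmono.injective (by rw [h, phaseAngle_nat_mul_pi ha hx₀, hm])
    rw [this, Real.sin_nat_mul_pi]

/-- Angle and time are both increasing functions of the phase: the angle determines the phase, and
the phase the time. -/
lemma existsUnique_hittingTime (hβ : IsRadialParametrization β) {a s θ : ℝ} (h : (a, s) ∈ strip)
    (hθ : 0 < θ) : ∃! t : ℝ, 0 < t ∧ (orthGeodesic β a s t).2 = θ := by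
  have hx₀ := initialCos_mem hβ h
  have ha : 0 < a := h.1
  obtain ⟨hp1, hp2, -⟩ := phase_spec ha hx₀
  rw [orthGeodesic_eq hβ h]
  obtain ⟨ψ, hψ⟩ := exists_phaseAngle_eq ha hx₀ θ
  have hmono := strictMono_phaseAngle ha hx₀
  have hψ0 : 0 < ψ := by
    rw [← hmono.lt_iff_lt, phaseAngle_zero, hψ]; exact hθ
  have htime : StrictMono (phaseTime a (initialCos β a s)) := by
    refine strictMono_of_deriv_pos fun ψ => ?_
    have h2 := Real.sqrt_pos.2 (one_sub_sq_pos hx₀)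
    have h3 := radialSpeed_pos ha (mul_cos_mem hx₀ ψ)
    rw [(hasDerivAt_phaseTime ψ).deriv]
    positivity
  refine ⟨phaseTime a (initialCos β a s) ψ, ⟨?_, ?_⟩, ?_⟩
  · simpa using htime hψ0
  · simp only [modelGeodesic, hp2, hψ]
  · rintro t ⟨-, ht⟩
    rw [← hp1 t]
    congr 1
    exact hmono.injective (ht.trans hψ.symm)

/-- Along the geodesic `ρ̇` is a positive factor times `x₀ sin ψ`. This replaces a condition on the
flow by level sets of the half period. -/
lemma closingFun_eq_zero_iff (hβ : IsRadialParametrization β) {k : ℕ} (hk : 0 < k) {a s : ℝ}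
    (h : (a, s) ∈ strip) : closingFun β k a s = 0 ↔
      initialCos β a s = 0 ∨ ∃ m : ℕ, 0 < m ∧ m * halfPeriod a (initialCos β a s) = k * Real.pi := by
  have hx₀ := initialCos_mem hβ h
  have ha : 0 < a := h.1
  have hθ : 0 < k * Real.pi := by have := Real.pi_pos; positivity
  obtain ⟨t, ht, hu⟩ := existsUnique_hittingTime hβ h hθ
  have hℓ : hittingTime β k a s = t := by
    have : {t : ℝ | 0 < t ∧ (orthGeodesic β a s t).2 = k * Real.pi} = {t} :=
      eq_singleton_iff_unique_mem.2 ⟨ht, fun y hy => hu y hy⟩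
    rw [hittingTime, this, csInf_singleton]
  have hd := (hasFDerivAt_fst.comp_hasDerivAt t (hasDerivAt_modelGeodesic ha hx₀ t)).deriv
  rw [orthGeodesic_eq hβ h] at ht
  rw [closingFun, hℓ, orthGeodesic_eq hβ h]
  change deriv (Prod.fst ∘ modelGeodesic a (initialCos β a s)) t = 0 ↔ _
  rw [hd, ← sin_eq_zero_iff_phaseAngle ha hx₀ hθ ht.2]
  have h1 := Real.sqrt_pos.2 (one_sub_sq_pos hx₀)
  have h2 := Real.sqrt_pos.2 (one_sub_sq_pos (mul_cos_mem hx₀ (phase a (initialCos β a s) t)))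
  have h3 := Real.pi_pos
  simp [ha.ne', h1.ne', h2.ne']

lemma initialCos_eq_zero_iff (hβ : IsRadialParametrization β) {a s : ℝ} (h : (a, s) ∈ strip) :
    initialCos β a s = 0 ↔ s = 0 := by
  have ha : 0 < a := h.1
  have hpi4 : Real.pi / 4 ∈ Ioo 0 (Real.pi / 2) := by
    have := Real.pi_pos
    constructor <;> linarith
  have h0 : initialCos β a 0 = 0 := by
    rw [initialCos, hβ.at_zero a ha, radialCos, polarAngle_arclength ha hpi4]
    rw [show 2 * (Real.pi / 4) = Real.pi / 2 by ring, Real.cos_pi_div_two]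
  have h00 : (a, (0 : ℝ)) ∈ strip := ⟨ha, by norm_num⟩
  constructor
  · intro hs
    have hmono : StrictMonoOn (β a) (Ioo (-1) 1) := by
      refine strictMonoOn_of_deriv_pos (convex_Ioo _ _) ?_ fun s hs => ?_
      · intro s hs
        exact (differentiableAt_of_deriv_ne_zero
          (hβ.deriv_pos a s ⟨ha, hs⟩).ne').continuousAt.continuousWithinAt
      · rw [interior_Ioo] at hs
        exact hβ.deriv_pos a s ⟨ha, hs⟩
    refine hmono.injOn h.2 h00.2 ?_
    rw [← radiusOfCos_radialCos ha (hβ.mem_Ioo a s h), ← radiusOfCos_radialCos ha (hβ.mem_Ioo a 0 h00)]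
    congr 1
    exact hs.trans h0.symm
  · rintro rfl
    exact h0

/-- On the Clifford geodesic the integrand is constant. This value determines the bifurcation
instants. -/
lemma halfPeriod_zero (a : ℝ) : halfPeriod a 0 = Real.pi * √(a ^ 2 + 1) / (2 * a) := by
  simp [halfPeriod, phaseAngle, radialSpeed]

/-! ### Analytic dependence of integrals on parameters

Integrands depending on parameters are viewed as analytic maps into the Banach algebra `C(X, ℝ)`. -/

section Sqrt

variable {X : Type*} [TopologicalSpace X]

lemma isUnit_of_forall_pos {f : C(X, ℝ)} (hf : ∀ x, 0 < f x) : IsUnit f :=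
  (ContinuousMap.isUnit_iff_forall_ne_zero f).2 fun x => (hf x).ne'

lemma ringInverse_apply {f : C(X, ℝ)} (hf : ∀ x, 0 < f x) (x : X) :
    Ring.inverse f x = (f x)⁻¹ := by
  have h := Ring.mul_inverse_cancel f (isUnit_of_forall_pos hf)
  exact eq_inv_of_mul_eq_one_right (congrArg (fun g : C(X, ℝ) => g x) h)

/-- The pointwise square root of a continuous function. -/
def sqrtMap (f : C(X, ℝ)) : C(X, ℝ) := ⟨fun x => √(f x), f.continuous.sqrt⟩

variable [CompactSpace X]

lemma isOpen_setOf_forall_pos : IsOpen {f : C(X, ℝ) | ∀ x, 0 < f x} := by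
  have := ContinuousMap.isOpen_setOfPred_mapsTo (X := X) (Y := ℝ) isCompact_univ
    (isOpen_Ioi (a := (0 : ℝ)))
  simpa [MapsTo] using this

/-- The square root is a local inverse of squaring, whose derivative at `y₀` is multiplication by
the unit `2 y₀`, so the analytic inverse function theorem applies. -/
lemma contDiffAt_sqrtMap {f : C(X, ℝ)} (hf : ∀ x, 0 < f x) : ContDiffAt ℝ ω sqrtMap f := by
  set y₀ := sqrtMap f with hy₀
  have hypos : ∀ x, 0 < y₀ x := fun x => Real.sqrt_pos.2 (hf x)
  let z : C(X, ℝ) := ⟨fun x => (2 * y₀ x)⁻¹,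
    Continuous.inv₀ (by fun_prop) fun x => (mul_pos two_pos (hypos x)).ne'⟩
  let L : C(X, ℝ) →L[ℝ] C(X, ℝ) := ContinuousLinearMap.mul ℝ C(X, ℝ) (2 * y₀)
  let M : C(X, ℝ) →L[ℝ] C(X, ℝ) := ContinuousLinearMap.mul ℝ C(X, ℝ) z
  have hzy : z * (2 * y₀) = 1 := by
    ext x
    exact inv_mul_cancel₀ (mul_pos two_pos (hypos x)).ne'
  let e : C(X, ℝ) ≃L[ℝ] C(X, ℝ) := ContinuousLinearEquiv.equivOfInverse L M
    (fun g => by simp only [L, M, ContinuousLinearMap.mul_apply', ← mul_assoc, hzy, one_mul])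
    (fun g => by simp only [L, M, ContinuousLinearMap.mul_apply', ← mul_assoc, mul_comm _ z, hzy,
      one_mul])
  have hsq : ContDiffAt ℝ ω (fun y : C(X, ℝ) => y * y) y₀ := by fun_prop
  have hder : HasFDerivAt (fun y : C(X, ℝ) => y * y) (e : C(X, ℝ) →L[ℝ] C(X, ℝ)) y₀ := by
    refine ((hasFDerivAt_id y₀).mul (hasFDerivAt_id y₀)).congr_fderiv ?_
    ext1 g
    change y₀ * g + y₀ * g = 2 * y₀ * g
    ring
  have hyy : y₀ * y₀ = f := by
    ext x
    exact Real.mul_self_sqrt (hf x).le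
  have hinv := hsq.to_localInverse hder (by simp)
  have hself := hsq.localInverse_apply_image hder (by simp)
  have hev := (hsq.hasStrictFDerivAt' hder (by simp)).eventually_right_inverse
  change ∀ᶠ y in 𝓝 (y₀ * y₀), hsq.localInverse hder (by simp) y *
    hsq.localInverse hder (by simp) y = y at hev
  simp only [hyy] at hinv hself hev
  refine hinv.congr_of_eventuallyEq ?_
  -- A right inverse of squaring is a square root only up to a sign at each point; positivity near
  -- `f` selects the right one.
  have hpos := hinv.continuousAt.eventually (isOpen_setOf_forall_pos.mem_nhds
    (show hsq.localInverse hder (by simp) f ∈ {f : C(X, ℝ) | ∀ x, 0 < f x} by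
      rw [hself]; exact hypos))
  filter_upwards [hev, hpos] with g hg hg'
  ext x
  have hx : hsq.localInverse hder (by simp) g x * hsq.localInverse hder (by simp) g x = g x := by
    conv_rhs => rw [← hg]
    rfl
  change √(g x) = _
  rw [← hx, Real.sqrt_mul_self (hg' x).le]

lemma contDiffAt_inverse_of_forall_pos {f : C(X, ℝ)} (hf : ∀ x, 0 < f x) :
    ContDiffAt ℝ ω (Ring.inverse : C(X, ℝ) → C(X, ℝ)) f := by
  obtain ⟨u, rfl⟩ := isUnit_of_forall_pos hf
  exact contDiffAt_ringInverse ℝ u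

end Sqrt

/-- Integration over `[0, b]` as a continuous linear functional. -/
def integralFunctional {b : ℝ} (hb : 0 ≤ b) : C(Icc 0 b, ℝ) →L[ℝ] ℝ :=
  LinearMap.mkContinuous
    { toFun := fun f => ∫ ξ in (0 : ℝ)..b, IccExtend hb f ξ
      map_add' := fun f g => intervalIntegral.integral_add
        ((f.continuous.Icc_extend' (h := hb)).intervalIntegrable 0 b)
        ((g.continuous.Icc_extend' (h := hb)).intervalIntegrable 0 b)
      map_smul' := fun c f => intervalIntegral.integral_const_mul c _ }
    b fun f => by
      have := intervalIntegral.norm_integral_le_of_norm_le_const (a := 0) (b := b) (C := ‖f‖)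
        (f := IccExtend hb f) fun x _ => f.norm_coe_le_norm _
      rwa [sub_zero, abs_of_nonneg hb, mul_comm] at this

lemma integralFunctional_apply {b : ℝ} (hb : 0 ≤ b) (f : C(Icc 0 b, ℝ)) {g : ℝ → ℝ}
    (h : ∀ x : Icc 0 b, f x = g x) : integralFunctional hb f = ∫ ξ in (0 : ℝ)..b, g ξ := by
  change (∫ ξ in (0 : ℝ)..b, IccExtend hb f ξ) = _
  refine intervalIntegral.integral_congr fun ξ hξ => ?_
  rw [uIcc_of_le hb] at hξ
  rw [IccExtend_of_mem hb _ hξ, h]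

/-- The substitutions `u = sin ξ` and `u = v sin φ` fix the interval of integration, so that the
parameters enter only through the integrand and the prefactor. -/
lemma arclength_eq (a φ : ℝ) : arclength a φ = 2 * Real.pi * (Real.sin φ *
    ∫ v in (0 : ℝ)..1, √(a ^ 2 * (1 - (Real.sin φ * v) ^ 2) + (Real.sin φ * v) ^ 2)) := by
  have h1 := intervalIntegral.integral_comp_mul_deriv (a := 0) (b := φ)
    (f := Real.sin) (f' := Real.cos) (g := fun u => √(a ^ 2 * (1 - u ^ 2) + u ^ 2))
    (fun x _ => Real.hasDerivAt_sin x) Real.continuous_cos.continuousOn (by fun_prop)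
  have h2 := intervalIntegral.smul_integral_comp_mul_left (a := 0) (b := 1)
    (fun u => √(a ^ 2 * (1 - u ^ 2) + u ^ 2)) (Real.sin φ)
  rw [smul_eq_mul, mul_zero, mul_one] at h2
  rw [h2, arclength]
  rw [Real.sin_zero] at h1
  rw [← h1]
  congr 1
  refine intervalIntegral.integral_congr fun ξ _ => ?_
  simp only [Function.comp_apply, ← Real.cos_sq']
  ring

lemma contDiffAt_arclength {a φ : ℝ} (ha : 0 < a) (hφ : φ ∈ Ioo 0 (Real.pi / 2)) :
    ContDiffAt ℝ ω (fun p : ℝ × ℝ => arclength p.1 p.2) (a, φ) := by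
  have hs0 : 0 < Real.sin φ := Real.sin_pos_of_pos_of_lt_pi hφ.1 (by linarith [hφ.2, Real.pi_pos])
  let v : C(Icc (0 : ℝ) 1, ℝ) := ⟨fun x => x, continuous_subtype_val⟩
  let N : ℝ × ℝ → C(Icc (0 : ℝ) 1, ℝ) := fun p =>
    p.1 ^ 2 • (1 - (Real.sin p.2 • v) ^ 2) + (Real.sin p.2 • v) ^ 2
  have hsin : ContDiff ℝ ω fun p : ℝ × ℝ => Real.sin p.2 := Real.contDiff_sin.comp contDiff_snd
  have hN : ContDiffAt ℝ ω N (a, φ) := by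
    have : ContDiff ℝ ω N := by fun_prop
    exact this.contDiffAt
  have hpos : ∀ x, 0 < N (a, φ) x := by
    intro x
    change 0 < a ^ 2 * (1 - (Real.sin φ * x.1) ^ 2) + (Real.sin φ * x.1) ^ 2
    have h1 : (Real.sin φ * x.1) ^ 2 ≤ 1 := by
      have h2 := Real.sin_le_one φ
      have h3 : Real.sin φ * x.1 ≤ 1 := mul_le_one₀ h2 x.2.1 x.2.2
      have h4 := mul_nonneg hs0.le x.2.1
      nlinarith
    rcases h1.lt_or_eq with h | h
    · have : 0 < 1 - (Real.sin φ * x.1) ^ 2 := by linarith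
      positivity
    · rw [h]; norm_num
  have hF : ContDiffAt ℝ ω (fun p : ℝ × ℝ => 2 * Real.pi * (Real.sin p.2 *
      integralFunctional zero_le_one (sqrtMap (N p)))) (a, φ) :=
    contDiffAt_const.mul (hsin.contDiffAt.mul
      ((integralFunctional zero_le_one).contDiff.contDiffAt.comp _
        ((contDiffAt_sqrtMap hpos).comp _ hN)))
  refine hF.congr_of_eventuallyEq (.of_forall fun p => ?_)
  simp only
  rw [arclength_eq, integralFunctional_apply zero_le_one (sqrtMap (N p))
    (g := fun v => √(p.1 ^ 2 * (1 - (Real.sin p.2 * v) ^ 2) + (Real.sin p.2 * v) ^ 2)) fun x => rfl]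

/-- The half period is a prefactor times a continuous linear functional of an element of `C([0, π],
ℝ)` built from the parameters by polynomials, a square root and an inverse. -/
lemma contDiffAt_halfPeriod {a x₀ : ℝ} (ha : 0 < a) (hx₀ : x₀ ∈ Ioo (-1 : ℝ) 1) :
    ContDiffAt ℝ ω (fun p : ℝ × ℝ => halfPeriod p.1 p.2) (a, x₀) := by
  let c : C(Icc (0 : ℝ) Real.pi, ℝ) := ⟨fun x => Real.cos x, by fun_prop⟩
  let N : ℝ × ℝ → C(Icc (0 : ℝ) Real.pi, ℝ) := fun p =>
    (1 + p.2 • c) * (p.1 ^ 2 • (1 + p.2 • c) + (1 - p.2 • c))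
  let Q : ℝ × ℝ → C(Icc (0 : ℝ) Real.pi, ℝ) := fun p => 1 - (p.2 • c) ^ 2
  have hN : ContDiffAt ℝ ω N (a, x₀) := by
    have : ContDiff ℝ ω N := by fun_prop
    exact this.contDiffAt
  have hQ : ContDiffAt ℝ ω Q (a, x₀) := by
    have : ContDiff ℝ ω Q := by fun_prop
    exact this.contDiffAt
  have hNpos : ∀ x, 0 < N (a, x₀) x := by
    intro x
    change 0 < (1 + x₀ * Real.cos x) * (a ^ 2 * (1 + x₀ * Real.cos x) + (1 - x₀ * Real.cos x))
    have h := mul_cos_mem hx₀ x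
    have h1 : 0 < 1 + x₀ * Real.cos x := by linarith [h.1]
    have h2 : 0 < 1 - x₀ * Real.cos x := by linarith [h.2]
    positivity
  have hQpos : ∀ p : ℝ × ℝ, p.2 ∈ Ioo (-1 : ℝ) 1 → ∀ x, 0 < Q p x := fun p hp x =>
    one_sub_sq_pos (mul_cos_mem hp x)
  have hpi := Real.pi_pos.le
  have hsq : ContDiffAt ℝ ω (fun p : ℝ × ℝ => √(1 - p.2 ^ 2)) (a, x₀) :=
    ContDiffAt.sqrt (by fun_prop) (one_sub_sq_pos hx₀).ne'
  have hinv : ContDiffAt ℝ ω (fun p : ℝ × ℝ => (2 * p.1)⁻¹) (a, x₀) :=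
    ContDiffAt.inv (by fun_prop) (by positivity)
  have hF : ContDiffAt ℝ ω (fun p : ℝ × ℝ => √(1 - p.2 ^ 2) * (2 * p.1)⁻¹ *
      integralFunctional hpi (sqrtMap (N p) * Ring.inverse (Q p))) (a, x₀) :=
    (hsq.mul hinv).mul ((integralFunctional hpi).contDiff.contDiffAt.comp _
      (((contDiffAt_sqrtMap hNpos).comp _ hN).mul
        ((contDiffAt_inverse_of_forall_pos (hQpos _ hx₀)).comp _ hQ)))
  refine hF.congr_of_eventuallyEq ?_
  filter_upwards [(isOpen_Ioo.preimage continuous_snd).mem_nhds hx₀] with p hp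
  rw [integralFunctional_apply hpi (g := fun ξ => radialSpeed p.1 (p.2 * Real.cos ξ) *
    (1 - (p.2 * Real.cos ξ) ^ 2)⁻¹), ← intervalIntegral.integral_const_mul]
  · rw [halfPeriod, phaseAngle]
    congr 1
    funext ξ
    rw [div_eq_mul_inv, mul_inv]
    ring
  · intro x
    rw [ContinuousMap.mul_apply, ringInverse_apply (hQpos p hp)]
    rfl

/-! ### Analyticity of the starting value -/

/-- For a scalar unknown, the invertibility required by the implicit function theorem is a nonzero
partial derivative. -/
lemma isInvertible_comp_inr {E : Type*} [NormedAddCommGroup E] [NormedSpace ℝ E] {f : E × ℝ → ℝ}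
    {u : E × ℝ} {d : ℝ} (hf : DifferentiableAt ℝ f u)
    (hd : HasDerivAt (fun y => f (u.1, y)) d u.2) (hd0 : d ≠ 0) :
    (fderiv ℝ f u ∘L .inr ℝ E ℝ).IsInvertible := by
  have h : HasFDerivAt (fun y => f (u.1, y)) (fderiv ℝ f u ∘L .inr ℝ E ℝ) u.2 :=
    HasFDerivAt.comp u.2 (g := f) (f := fun y => (u.1, y)) hf.hasFDerivAt
      (hasFDerivAt_prodMk_right u.1 u.2)
  refine ⟨ContinuousLinearEquiv.unitsEquivAut ℝ (Units.mk0 d hd0), ?_⟩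
  rw [h.unique hd.hasFDerivAt]
  ext
  simp

lemma isOpen_strip : IsOpen strip := isOpen_Ioi.prod isOpen_Ioo

/-- The polar angle is defined by choice, so its analyticity comes from solving `arclength a φ = β a
s` for `φ` by the implicit function theorem. -/
lemma contDiffAt_initialCos (hβ : IsRadialParametrization β) {a s : ℝ} (h : (a, s) ∈ strip) :
    ContDiffAt ℝ ω (fun p : ℝ × ℝ => initialCos β p.1 p.2) (a, s) := by
  have ha : 0 < a := h.1
  have hφ := polarAngle_mem ha (hβ.mem_Ioo a s h)
  set φ := polarAngle a (β a s) with hφdef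
  let f : (ℝ × ℝ) × ℝ → ℝ := fun q => arclength q.1.1 q.2 - β q.1.1 q.1.2
  have hf : ContDiffAt ℝ ω f ((a, s), φ) := by
    refine ContDiffAt.sub ?_ ?_
    · exact ContDiffAt.comp (g := fun p : ℝ × ℝ => arclength p.1 p.2)
        (f := fun q : (ℝ × ℝ) × ℝ => (q.1.1, q.2)) ((a, s), φ) (contDiffAt_arclength ha hφ)
        (by fun_prop)
    · exact ContDiffAt.comp (g := fun p : ℝ × ℝ => β p.1 p.2)
        (f := fun q : (ℝ × ℝ) × ℝ => q.1) ((a, s), φ) (hβ.analytic _ h).contDiffAt contDiffAt_fst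
  have hω : (ω : WithTop ℕ∞) ≠ 0 := by simp
  have hinv := isInvertible_comp_inr (hf.differentiableAt hω)
    ((hasStrictDerivAt_arclength' (a := a) hφ).hasDerivAt.sub_const (β a s))
    (mul_pos Real.pi_pos (radialSpeed_pos ha (cos_two_mul_mem hφ))).ne'
  have hg := hf.contDiffAt_implicitFunction hω hinv
  have hself := hf.implicitFunction_apply_self hω hinv
  have hev := hf.eventually_apply_implicitFunction hω hinv
  set g := hf.implicitFunction hω hinv
  have hzero : f ((a, s), φ) = 0 := by
    simp only [f, hφdef, arclength_polarAngle ha (hβ.mem_Ioo a s h), sub_self]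
  -- In this interval the arclength is injective, which identifies the implicit solution with
  -- `polarAngle`.
  have hmem : ∀ᶠ p in 𝓝 (a, s), g p ∈ Ioo 0 (Real.pi / 2) :=
    hg.continuousAt.eventually (isOpen_Ioo.mem_nhds (by rw [hself]; exact hφ))
  refine (Real.contDiff_cos.contDiffAt.comp _ (contDiffAt_const.mul hg)).congr_of_eventuallyEq ?_
    (f₁ := fun p : ℝ × ℝ => initialCos β p.1 p.2) (f := fun p : ℝ × ℝ => Real.cos (2 * g p))
  filter_upwards [hev, hmem, isOpen_strip.mem_nhds h] with p hp hp' hps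
  rw [hzero] at hp
  rw [initialCos, radialCos, ← sub_eq_zero.1 hp, polarAngle_arclength hps.1 hp']

/-- The half period of `γ_{a,s}` depends analytically on `(a, s)`. -/
lemma contDiffAt_halfPeriod_initialCos (hβ : IsRadialParametrization β) {a s : ℝ}
    (h : (a, s) ∈ strip) :
    ContDiffAt ℝ ω (fun p : ℝ × ℝ => halfPeriod p.1 (initialCos β p.1 p.2)) (a, s) :=
  ContDiffAt.comp (g := fun p : ℝ × ℝ => halfPeriod p.1 p.2)
    (f := fun p : ℝ × ℝ => (p.1, initialCos β p.1 p.2)) (a, s)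
    (contDiffAt_halfPeriod h.1 (initialCos_mem hβ h))
    (contDiffAt_fst.prodMk (contDiffAt_initialCos hβ h))

/-! ### The bifurcation instants -/

lemma bifInstant_pos {j k : ℕ} (hj : 0 < j) (hjk : j < 2 * k) : 0 < bifInstant j k := by
  have hk : (0 : ℝ) < k := by exact_mod_cast (by omega : 0 < k)
  have hj' : (0 : ℝ) < j := by exact_mod_cast hj
  have hjk' : (j : ℝ) < 2 * k := by exact_mod_cast hjk
  have h1 : (j : ℝ) / k < 2 := by rw [div_lt_iff₀ hk]; exact hjk'
  have h2 : 0 < (j : ℝ) / k := by positivity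
  have h3 : 0 < 4 - ((j : ℝ) / k) ^ 2 := by nlinarith
  exact div_pos h2 (Real.sqrt_pos.2 h3)

/-- The equation reads `m √(a² + 1) = 2ka`. As `√(a² + 1) > a`, it forces `m < 2k`; squaring and
solving for `a` gives the bifurcation instant. -/
lemma nat_mul_halfPeriod_zero_eq_iff {a : ℝ} (ha : 0 < a) {m k : ℕ} (hm : 0 < m) (hk : 0 < k) :
    m * halfPeriod a 0 = k * Real.pi ↔ m < 2 * k ∧ a = bifInstant m k := by
  have hpi := Real.pi_pos
  have hk' : (0 : ℝ) < k := by exact_mod_cast hk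
  have hm' : (0 : ℝ) < m := by exact_mod_cast hm
  have hR := Real.sqrt_pos.2 (by positivity : 0 < a ^ 2 + 1)
  have hR2 := Real.sq_sqrt (by positivity : 0 ≤ a ^ 2 + 1)
  have h1 : m * halfPeriod a 0 = k * Real.pi ↔ m * √(a ^ 2 + 1) = 2 * k * a := by
    rw [halfPeriod_zero]
    constructor
    · intro h
      field_simp at h
      linarith
    · intro h
      field_simp
      linarith
  rw [h1]
  set R := √(a ^ 2 + 1)
  have h2 : ((m : ℝ) / k) ^ 2 = m ^ 2 / k ^ 2 := by rw [div_pow]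
  constructor
  · intro h
    have hRa : a < R := by nlinarith
    have hlt : (m : ℝ) < 2 * k := by
      by_contra hc
      have := mul_le_mul (not_lt.1 hc) hRa.le ha.le hm'.le
      nlinarith
    refine ⟨by exact_mod_cast hlt, ?_⟩
    have hsq : (m : ℝ) ^ 2 * (a ^ 2 + 1) = 4 * k ^ 2 * a ^ 2 := by
      rw [← hR2, ← mul_pow, h]; ring
    have hpos : 0 < 4 - ((m : ℝ) / k) ^ 2 := by
      rw [h2, sub_pos, div_lt_iff₀ (by positivity)]; nlinarith
    have hroot : √(4 - ((m : ℝ) / k) ^ 2) = m / (k * a) := by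
      rw [Real.sqrt_eq_iff_mul_self_eq hpos.le (by positivity)]
      field_simp
      linarith
    rw [bifInstant, hroot]
    field_simp
  · rintro ⟨hlt, h⟩
    have hlt' : (m : ℝ) < 2 * k := by exact_mod_cast hlt
    have hpos : 0 < 4 - ((m : ℝ) / k) ^ 2 := by
      rw [h2, sub_pos, div_lt_iff₀ (by positivity)]; nlinarith
    have hroot := Real.sqrt_pos.2 hpos
    have hroot2 := Real.sq_sqrt hpos.le
    rw [bifInstant, eq_div_iff hroot.ne'] at h
    have hsq : a ^ 2 * (4 - ((m : ℝ) / k) ^ 2) = ((m : ℝ) / k) ^ 2 := by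
      rw [← hroot2, ← mul_pow, h]
    have h4 : (m * R) ^ 2 = (2 * k * a) ^ 2 := by
      rw [mul_pow, hR2]
      field_simp at hsq
      linarith
    exact (pow_left_inj₀ (by positivity) (by positivity) two_ne_zero).1 h4

/-- The nonvanishing derivative is the transversality condition at a bifurcation instant: it allows
`a` to be solved for. -/
lemma hasDerivAt_halfPeriod_zero {a : ℝ} (ha : 0 < a) :
    ∃ d < 0, HasDerivAt (fun a => halfPeriod a 0) d a := by
  have hpos : 0 < a ^ 2 + 1 := by positivity
  have hR := Real.sqrt_pos.2 hpos
  have hR2 := Real.sq_sqrt hpos.le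
  have h := ((((((hasDerivAt_id a).pow 2).add_const 1).sqrt hpos.ne').const_mul Real.pi).div
    ((hasDerivAt_id a).const_mul 2) (by simpa using ha.ne'))
  have e : (fun a => halfPeriod a 0) = fun a => Real.pi * √(a ^ 2 + 1) / (2 * a) :=
    funext halfPeriod_zero
  rw [e]
  refine ⟨-(Real.pi / (2 * a ^ 2 * √(a ^ 2 + 1))), by have := Real.pi_pos; simp; positivity,
    h.congr_deriv ?_⟩
  simp only [id, Pi.pow_apply]
  norm_num
  field_simp
  rw [hR2]
  ring

/-- Conditions `m * H ≠ c` on multiples of a positive function are open, uniformly in `m`. -/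
lemma eventually_nat_mul_ne {X : Type*} [TopologicalSpace X] {H : X → ℝ} {p : X} {c : ℝ}
    (hH : ContinuousAt H p) (hpos : 0 < H p) {P : ℕ → Prop} (hne : ∀ m : ℕ, P m → m * H p ≠ c) :
    ∀ᶠ q in 𝓝 p, ∀ m : ℕ, P m → m * H q ≠ c := by
  -- Where `H > H p / 2`, every `m ≥ N` gives `m * H > c`, so only finitely many conditions remain.
  obtain ⟨N, hN⟩ := exists_nat_gt (c / (H p / 2))
  rw [div_lt_iff₀ (by positivity)] at hN
  have h1 : ∀ᶠ q in 𝓝 p, H p / 2 < H q := hH.eventually (lt_mem_nhds (by linarith))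
  have h2 : ∀ᶠ q in 𝓝 p, ∀ m ∈ Finset.range N, P m → m * H q ≠ c := by
    refine (Finset.eventually_all _).2 fun m _ => ?_
    by_cases hm : P m
    · filter_upwards [(continuousAt_const.mul hH).eventually_ne (hne m hm)] with q hq _
      exact hq
    · exact .of_forall fun q h => absurd h hm
  filter_upwards [h1, h2] with q hq1 hq2 m hm
  by_cases hmN : m < N
  · exact hq2 m (Finset.mem_range.2 hmN) hm
  · have : (N : ℝ) ≤ m := by exact_mod_cast not_lt.1 hmN
    have h0 : (0 : ℝ) ≤ N := Nat.cast_nonneg N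
    refine ne_of_gt (hN.trans_le ?_)
    exact mul_le_mul this hq1.le (by positivity) (h0.trans this)

/-! ### Zeros of `f_k` near the trivial branch. -/

lemma mem_zeroSet_iff (hβ : IsRadialParametrization β) {k : ℕ} (hk : 0 < k) {p : ℝ × ℝ}
    (hp : p ∈ strip) : p ∈ zeroSet β k ↔
      p.2 = 0 ∨ ∃ m : ℕ, 0 < m ∧ m * halfPeriod p.1 (initialCos β p.1 p.2) = k * Real.pi := by
  rw [zeroSet, Set.mem_ofPred_eq, closingFun_eq_zero_iff hβ hk hp, initialCos_eq_zero_iff hβ hp]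
  exact and_iff_right hp

lemma mem_strip_zero {a : ℝ} (ha : 0 < a) : (a, (0 : ℝ)) ∈ strip := ⟨ha, by norm_num⟩

/-- The zero set near a point of the trivial branch that is not a bifurcation instant. -/
theorem exists_nhd_zeroSet_eq_trivialBranch (hβ : IsRadialParametrization β) {k : ℕ} (hk : 0 < k)
    {a : ℝ} (ha : 0 < a) (hne : ∀ j : ℕ, 0 < j → j < 2 * k → a ≠ bifInstant j k) :
    ∃ V : Set (ℝ × ℝ), IsOpen V ∧ V ⊆ strip ∧ (a, 0) ∈ V ∧
      zeroSet β k ∩ V = trivialBranch ∩ V := by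
  have hst := mem_strip_zero ha
  have h0 := (initialCos_eq_zero_iff hβ hst).2 rfl
  have hev := eventually_nat_mul_ne (contDiffAt_halfPeriod_initialCos hβ hst).continuousAt
    (halfPeriod_pos ha (initialCos_mem hβ hst)) (P := fun m => 0 < m) (c := k * Real.pi)
    fun m hm h => by
      simp only [h0] at h
      obtain ⟨h1, h2⟩ := (nat_mul_halfPeriod_zero_eq_iff ha hm hk).1 h
      exact hne m hm h1 h2
  obtain ⟨V, hV, hVo, hVm⟩ := mem_nhds_iff.1 (hev.and (isOpen_strip.mem_nhds hst))
  refine ⟨V, hVo, fun p hp => (hV hp).2, hVm, ?_⟩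
  ext p
  refine and_congr_left fun hp => ?_
  obtain ⟨h1, h2⟩ := hV hp
  rw [mem_zeroSet_iff hβ hk h2]
  constructor
  · rintro (h | ⟨m, hm, h⟩)
    · exact ⟨h2.1, h⟩
    · exact absurd h (h1 m hm)
  · exact fun h => .inl h.2

/-- The zero set near a bifurcation instant. -/
theorem exists_bifurcating_branch (hβ : IsRadialParametrization β) {k : ℕ}
    {j : ℕ} (hj : 0 < j) (hjk : j < 2 * k) :
    ∃ U : Set (ℝ × ℝ), IsOpen U ∧ U ⊆ strip ∧ (bifInstant j k, 0) ∈ U ∧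
      ∃ ε : ℝ, 0 < ε ∧ ∃ A S : ℝ → ℝ,
        AnalyticOnNhd ℝ A (Set.Ioo (-ε) ε) ∧ AnalyticOnNhd ℝ S (Set.Ioo (-ε) ε) ∧
        (∀ t ∈ Set.Ioo (-ε) ε, (A t, S t) ∈ U) ∧
        A 0 = bifInstant j k ∧ S 0 = 0 ∧ 0 < deriv S 0 ∧
        zeroSet β k ∩ U =
          (trivialBranch ∩ U) ∪ (fun t => (A t, S t)) '' Set.Ioo (-ε) ε := by
  have hk : 0 < k := by omega
  have ha := bifInstant_pos hj hjk
  set a := bifInstant j k with ha_def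
  have hst := mem_strip_zero ha
  have h0 : ∀ a, 0 < a → initialCos β a 0 = 0 := fun a ha =>
    (initialCos_eq_zero_iff hβ (mem_strip_zero ha)).2 rfl
  have hH := contDiffAt_halfPeriod_initialCos hβ hst
  set H : ℝ × ℝ → ℝ := fun p => halfPeriod p.1 (initialCos β p.1 p.2) with hHdef
  have hHa : H (a, 0) = halfPeriod a 0 := by simp only [hHdef, h0 a ha]
  have hj' : (0 : ℝ) < j := by exact_mod_cast hj
  have hHj : j * H (a, 0) = k * Real.pi := by
    rw [hHa, nat_mul_halfPeriod_zero_eq_iff ha hj hk]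
    exact ⟨hjk, rfl⟩
  have hHpos : 0 < H (a, 0) := halfPeriod_pos ha (initialCos_mem hβ hst)
  -- As `H (a, 0)` is positive, `m = j` is the only solution at `(a, 0)`, and therefore the only
  -- possible one nearby.
  have hev := eventually_nat_mul_ne hH.continuousAt hHpos (P := fun m => m ≠ j)
    (c := k * Real.pi) fun m hm h => by
      rw [← hHj] at h
      exact hm (by exact_mod_cast mul_right_cancel₀ hHpos.ne' h)
  have hω : (ω : WithTop ℕ∞) ≠ 0 := by simp
  -- The variables are swapped because the implicit function theorem solves for the second one,
  -- which has to be `a`.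
  have hf : ContDiffAt ℝ ω (fun q : ℝ × ℝ => H (q.2, q.1)) (0, a) :=
    ContDiffAt.comp (g := H) (f := fun q : ℝ × ℝ => (q.2, q.1)) (0, a) hH
      (contDiffAt_snd.prodMk contDiffAt_fst)
  obtain ⟨d, hd, hder⟩ := hasDerivAt_halfPeriod_zero ha
  have hder' : HasDerivAt (fun y => H (y, 0)) d a := by
    refine hder.congr_of_eventuallyEq ?_
    filter_upwards [lt_mem_nhds ha] with y hy
    simp only [hHdef, h0 y hy]
  have hinv := isInvertible_comp_inr (hf.differentiableAt hω) hder' hd.ne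
  have hA := hf.contDiffAt_implicitFunction hω hinv
  have hself := hf.implicitFunction_apply_self hω hinv
  have himp := hf.eventually_apply_eq_iff_implicitFunction hω hinv
  set A := hf.implicitFunction hω hinv
  have himp' : ∀ᶠ p : ℝ × ℝ in 𝓝 (a, 0), (H p = H (a, 0) ↔ A p.2 = p.1) :=
    (continuous_swap.tendsto (a, (0 : ℝ))).eventually himp
  obtain ⟨u, v, hu, hau, hv, h0v, huv⟩ := mem_nhds_prod_iff'.1
    ((hev.and himp').and (isOpen_strip.mem_nhds hst))
  have hAev : ∀ᶠ s in 𝓝 (0 : ℝ), (s ∈ v ∧ A s ∈ u) ∧ AnalyticAt ℝ A s :=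
    ((hv.eventually_mem h0v).and (hA.continuousAt.eventually (hu.mem_nhds (by rw [hself]; exact hau)))).and
      hA.analyticAt.eventually_analyticAt
  obtain ⟨ε, hε, hball⟩ := Metric.eventually_nhds_iff_ball.1 hAev
  rw [Real.ball_eq_Ioo, zero_sub, zero_add] at hball
  have hsub : ∀ p ∈ u ×ˢ Ioo (-ε) ε, p ∈ u ×ˢ v := fun p hp => ⟨hp.1, (hball _ hp.2).1.1⟩
  -- The branch is a graph over `s`, so `S` is the identity with derivative 1. Cutting the
  -- neighborhood to `|s| < ε` makes the curve exhaust the graph inside it.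
  refine ⟨u ×ˢ Ioo (-ε) ε, hu.prod isOpen_Ioo, fun p hp => (huv (hsub p hp)).2,
    ⟨hau, by simpa using hε⟩, ε, hε, A, id, fun t ht => (hball t ht).2, fun t _ => analyticAt_id,
    fun t ht => ⟨(hball t ht).1.2, ht⟩, hself, rfl, by simp, ?_⟩
  ext p
  constructor
  · rintro ⟨hz, hp⟩
    obtain ⟨⟨h1, h2⟩, h3⟩ := huv (hsub p hp)
    rcases (mem_zeroSet_iff hβ hk h3).1 hz with h | ⟨m, hm, h⟩
    · exact .inl ⟨⟨h3.1, h⟩, hp⟩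
    · right
      have hmj : m = j := by
        by_contra hc
        exact h1 m hc h
      rw [hmj, ← hHj] at h
      exact ⟨p.2, hp.2, Prod.ext (h2.1 (mul_left_cancel₀ hj'.ne' h)) rfl⟩
  · rintro (⟨h, hp⟩ | ⟨t, ht, rfl⟩)
    · exact ⟨(mem_zeroSet_iff hβ hk (huv (hsub p hp)).2).2 (.inl h.2), hp⟩
    · have hp : (A t, id t) ∈ u ×ˢ Ioo (-ε) ε := ⟨(hball t ht).1.2, ht⟩
      obtain ⟨⟨h1, h2⟩, h3⟩ := huv (hsub _ hp)
      refine ⟨(mem_zeroSet_iff hβ hk h3).2 (.inr ⟨j, hj, ?_⟩), hp⟩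
      rw [← hHj]
      congr 1
      exact h2.2 rfl

/-! ### Closed profile curves of minimal tori -/

/-- The function `a² cos² φ + sin² φ`. -/
def meridianFactor (a φ : ℝ) : ℝ := a ^ 2 * Real.cos φ ^ 2 + Real.sin φ ^ 2

/-- The equation of unparametrized geodesics `u ↦ (φ(u), Θ(u))` of the orbit space; the arguments
are the values of `φ`, `φ'`, `φ''`, `Θ'`, `Θ''`. -/
def ProfileEquation (a φ φ₁ φ₂ Θ₁ Θ₂ : ℝ) : Prop :=
  Real.sin φ * Real.cos φ * meridianFactor a φ * (φ₂ * Θ₁ - φ₁ * Θ₂) =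
    Θ₁ * (a ^ 2 * Real.sin φ ^ 2 * (Real.cos φ ^ 2 - Real.sin φ ^ 2) * Θ₁ ^ 2 +
      φ₁ ^ 2 * (Real.cos φ ^ 2 * (a ^ 2 * Real.sin φ ^ 2 + 2 * meridianFactor a φ -
        Real.sin φ ^ 2) - Real.sin φ ^ 2 * meridianFactor a φ))

lemma meridianFactor_pos {a φ : ℝ} (hφ : φ ∈ Ioo 0 (Real.pi / 2)) : 0 < meridianFactor a φ := by
  have hs : 0 < Real.sin φ := Real.sin_pos_of_pos_of_lt_pi hφ.1 (by linarith [hφ.2, Real.pi_pos])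
  unfold meridianFactor
  positivity

lemma HasDerivAt.meridianFactor {a φ₁ u : ℝ} {φ : ℝ → ℝ} (h : HasDerivAt φ φ₁ u) :
    HasDerivAt (fun u => meridianFactor a (φ u))
      (2 * (1 - a ^ 2) * Real.sin (φ u) * Real.cos (φ u) * φ₁) u := by
  refine (((h.cos.pow 2).const_mul (a ^ 2)).add (h.sin.pow 2)).congr_deriv ?_
  norm_num
  ring

/-- A solution of the profile equation is one of the explicit curves `cos 2φ = x₀ cos ψ`. -/
theorem exists_phase_of_profileEquation {a : ℝ} (ha : 0 < a) {φ φ₁ φ₂ Θ Θ₁ Θ₂ : ℝ → ℝ}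
    (hφ : ∀ u, HasDerivAt φ (φ₁ u) u) (hφ₁ : ∀ u, HasDerivAt φ₁ (φ₂ u) u)
    (hΘ : ∀ u, HasDerivAt Θ (Θ₁ u) u) (hΘ₁ : ∀ u, HasDerivAt Θ₁ (Θ₂ u) u)
    (hmem : ∀ u, φ u ∈ Ioo 0 (Real.pi / 2)) (hpos : ∀ u, 0 < Θ₁ u)
    (heq : ∀ u, ProfileEquation a (φ u) (φ₁ u) (φ₂ u) (Θ₁ u) (Θ₂ u)) {u₀ : ℝ} (h0 : φ₁ u₀ = 0) :
    ∃ ψ : ℝ → ℝ, ∀ u, Real.cos (2 * φ u) = Real.cos (2 * φ u₀) * Real.cos (ψ u) ∧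
      phaseAngle a (Real.cos (2 * φ u₀)) (ψ u) = Θ u - Θ u₀ := by
  set s : ℝ → ℝ := fun u => Real.sin (φ u) with hs_def
  set c : ℝ → ℝ := fun u => Real.cos (φ u) with hc_def
  set E : ℝ → ℝ := fun u => meridianFactor a (φ u) with hE_def
  -- The slope `dφ/dΘ` is independent of the parametrization, and the second derivatives enter the
  -- equation only through its derivative.
  set y : ℝ → ℝ := fun u => φ₁ u / Θ₁ u with hy_def
  set x : ℝ → ℝ := fun u => Real.cos (2 * φ u) with hx_def
  set x₀ := Real.cos (2 * φ u₀) with hx₀_def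
  have hpi := Real.pi_pos
  have hs : ∀ u, 0 < s u := fun u =>
    Real.sin_pos_of_pos_of_lt_pi (hmem u).1 (by linarith [(hmem u).2])
  have hc : ∀ u, 0 < c u := fun u =>
    Real.cos_pos_of_mem_Ioo ⟨by linarith [(hmem u).1], (hmem u).2⟩
  have hE : ∀ u, 0 < E u := fun u => meridianFactor_pos (hmem u)
  have hsd : ∀ u, HasDerivAt s (c u * φ₁ u) u := fun u => (hφ u).sin
  have hcd : ∀ u, HasDerivAt c (-s u * φ₁ u) u := fun u => (hφ u).cos
  have hEd : ∀ u, HasDerivAt E (2 * (1 - a ^ 2) * s u * c u * φ₁ u) u := fun u =>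
    (hφ u).meridianFactor
  have hφy : ∀ u, φ₁ u = y u * Θ₁ u := fun u => (div_mul_cancel₀ _ (hpos u).ne').symm
  clear_value y
  have hy : ∀ u, HasDerivAt y (Θ₁ u * (a ^ 2 * s u ^ 2 * (c u ^ 2 - s u ^ 2) +
      y u ^ 2 * (c u ^ 2 * (a ^ 2 * s u ^ 2 + 2 * E u - s u ^ 2) - s u ^ 2 * E u)) /
      (s u * c u * E u)) u := by
    intro u
    have hdiv : HasDerivAt (fun u => φ₁ u / Θ₁ u) _ u := (hφ₁ u).div (hΘ₁ u) (hpos u).ne'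
    rw [← hy_def] at hdiv
    refine hdiv.congr_deriv ?_
    have h := heq u
    unfold ProfileEquation at h
    change s u * c u * E u * (φ₂ u * Θ₁ u - φ₁ u * Θ₂ u) =
      Θ₁ u * (a ^ 2 * s u ^ 2 * (c u ^ 2 - s u ^ 2) * Θ₁ u ^ 2 +
        φ₁ u ^ 2 * (c u ^ 2 * (a ^ 2 * s u ^ 2 + 2 * E u - s u ^ 2) - s u ^ 2 * E u)) at h
    have h1 := (hs u).ne'
    have h2 := (hc u).ne'
    have h3 := (hE u).ne'
    have h4 := (hpos u).ne'
    rw [div_eq_div_iff (pow_ne_zero 2 h4) (mul_ne_zero (mul_ne_zero h1 h2) h3)]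
    rw [hφy u] at h ⊢
    linear_combination h
  have hS : 1 - x₀ ^ 2 = 4 * s u₀ ^ 2 * c u₀ ^ 2 := by
    rw [hx₀_def, ← Real.sin_sq, Real.sin_two_mul]; ring
  have hx₀ : x₀ ∈ Ioo (-1 : ℝ) 1 := cos_two_mul_mem (hmem u₀)
  have hSpos := one_sub_sq_pos hx₀
  have hq := Real.sqrt_pos.2 hSpos
  have hq2 := Real.sq_sqrt hSpos.le
  -- Clairaut's relation for unparametrized geodesics. The conserved quotient equals `4a² / (1 -
  -- x₀²)`, its value at the critical point `u₀`, where `y = 0`.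
  have hint : ∀ u, (1 - x₀ ^ 2) * (E u * y u ^ 2 + a ^ 2 * s u ^ 2) =
      4 * a ^ 2 * s u ^ 4 * c u ^ 2 := by
    have h : ∀ u, HasDerivAt (fun u => (E u * y u ^ 2 + a ^ 2 * s u ^ 2) / (s u ^ 4 * c u ^ 2))
        0 u := by
      intro u
      have h1 := (hs u).ne'
      have h2 := (hc u).ne'
      have h3 := (hE u).ne'
      refine ((((hEd u).mul ((hy u).pow 2)).add (((hsd u).pow 2).const_mul (a ^ 2))).div
        (((hsd u).pow 4).mul ((hcd u).pow 2))
        (mul_ne_zero (pow_ne_zero 4 h1) (pow_ne_zero 2 h2))).congr_deriv ?_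
      rw [div_eq_zero_iff]
      left
      simp only [Pi.pow_apply, Pi.mul_apply, Pi.add_apply, hφy u, Nat.cast_ofNat, Nat.reduceSub, pow_one]
      field_simp
      ring
    intro u
    have := is_const_of_deriv_eq_zero (fun t => (h t).differentiableAt) (fun t => (h t).deriv) u u₀
    have hy0 : y u₀ = 0 := by simp only [hy_def, h0, zero_div]
    have h1 := (hs u).ne'
    have h2 := (hc u).ne'
    have h3 := (hs u₀).ne'
    have h4 := (hc u₀).ne'
    rw [hy0] at this
    field_simp at this
    rw [hS]
    refine mul_left_cancel₀ (pow_ne_zero 2 h3) ?_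
    linear_combination 4 * this
  set q := √(1 - x₀ ^ 2)
  have hxsc : ∀ u, x u = c u ^ 2 - s u ^ 2 := fun u => Real.cos_two_mul' _
  have hspeed : ∀ u, radialSpeed a (x u) = 2 * (c u * √(E u)) := by
    intro u
    have := radialSpeed_cos_two_mul (a := a) (hmem u)
    refine mul_left_cancel₀ hpi.ne' (this.symm.trans ?_)
    simp only [hE_def, hc_def, meridianFactor]
    ring
  set W : ℝ → ℝ := fun u => 4 * a * s u ^ 2 * c u / (q * √(E u)) * Θ₁ u with hW_def
  -- As for parametrized geodesics, the scaling makes the first integral read `x² + D² = x₀²`.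
  set D : ℝ → ℝ := fun u => q / a * (√(E u) * y u / s u) with hD_def
  have hEs : ∀ u, 0 < √(E u) := fun u => Real.sqrt_pos.2 (hE u)
  have hxW : ∀ u, HasDerivAt x (-(W u * D u)) u := by
    intro u
    refine ((hφ u).const_mul 2).cos.congr_deriv ?_
    have h1 := (hs u).ne'
    have h3 := (hEs u).ne'
    rw [Real.sin_two_mul, hφy u]
    change -(2 * s u * c u) * (2 * (y u * Θ₁ u)) = _
    simp only [hW_def, hD_def]
    field_simp
    ring
  have hDW : ∀ u, HasDerivAt D (W u * x u) u := by
    intro u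
    have h1 := (hs u).ne'
    have h2 := (hc u).ne'
    have h3 := (hEs u).ne'
    have h4 := (hE u).ne'
    refine ((((((hEd u).sqrt h4).mul (hy u)).div (hsd u) h1)).const_mul (q / a)).congr_deriv ?_
    have he := hint u
    have hE2 := Real.sq_sqrt (hE u).le
    rw [← hq2] at he
    simp only [hW_def, hφy u, hxsc u, Pi.mul_apply]
    set e := √(E u)
    rw [← hE2] at he ⊢
    field_simp at he ⊢
    linear_combination Θ₁ u * (c u ^ 2 - s u ^ 2) * he
  have hWc : Continuous W := by
    have h1 : Continuous s := continuous_iff_continuousAt.2 fun u => (hsd u).continuousAt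
    have h2 : Continuous c := continuous_iff_continuousAt.2 fun u => (hcd u).continuousAt
    have h3 : Continuous E := continuous_iff_continuousAt.2 fun u => (hEd u).continuousAt
    have h4 : Continuous Θ₁ := continuous_iff_continuousAt.2 fun u => (hΘ₁ u).continuousAt
    exact (Continuous.div (by fun_prop) (by fun_prop) fun u => (mul_pos hq (hEs u)).ne').mul h4
  set ψ : ℝ → ℝ := fun u => ∫ ξ in u₀..u, W ξ with hψ_def
  have hψ : ∀ u, HasDerivAt ψ (W u) u := fun u => (hWc.integral_hasStrictDerivAt u₀ u).hasDerivAt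
  have hψ0 : ψ u₀ = 0 := by simp [hψ_def]
  have hD0 : D u₀ = 0 := by simp [hD_def, hy_def, h0]
  have hrot := fun u => (eq_rotation hxW hDW hψ hψ0 hD0 u).1
  refine ⟨ψ, fun u => ⟨hrot u, ?_⟩⟩
  have h : ∀ u, HasDerivAt (fun u => phaseAngle a x₀ (ψ u) - Θ u) 0 u := by
    intro u
    refine (((hasDerivAt_phaseAngle ha hx₀ (ψ u)).comp u (hψ u)).sub (hΘ u)).congr_deriv ?_
    have hr : x₀ * Real.cos (ψ u) = x u := (hrot u).symm
    have hx2 : 1 - x u ^ 2 = 4 * s u ^ 2 * c u ^ 2 := by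
      simp only [hx_def, hs_def, hc_def]
      rw [← Real.sin_sq, Real.sin_two_mul]
      ring
    have h1 := (hs u).ne'
    have h2 := (hc u).ne'
    have h3 := (hEs u).ne'
    rw [hr, hspeed, hx2, show √(1 - x₀ ^ 2) = q from rfl]
    simp only [hW_def]
    field_simp
    ring
  have := is_const_of_deriv_eq_zero (fun t => (h t).differentiableAt) (fun t => (h t).deriv) u u₀
  simp only [hψ0, phaseAngle_zero] at this
  linarith

/-- A periodic solution of the profile equation is the Clifford geodesic, unless the closing
condition holds for a half period. -/
theorem cos_eq_zero_of_periodic {a : ℝ} (ha : 0 < a) {k : ℕ} (hk : 0 < k) {φ φ₁ φ₂ Θ Θ₁ Θ₂ : ℝ → ℝ}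
    (hφ : ∀ u, HasDerivAt φ (φ₁ u) u) (hφ₁ : ∀ u, HasDerivAt φ₁ (φ₂ u) u)
    (hΘ : ∀ u, HasDerivAt Θ (Θ₁ u) u) (hΘ₁ : ∀ u, HasDerivAt Θ₁ (Θ₂ u) u)
    (hmem : ∀ u, φ u ∈ Ioo 0 (Real.pi / 2)) (hpos : ∀ u, 0 < Θ₁ u)
    (heq : ∀ u, ProfileEquation a (φ u) (φ₁ u) (φ₂ u) (Θ₁ u) (Θ₂ u))
    (hφper : ∀ u, φ (u + 2 * Real.pi) = φ u)
    (hΘper : ∀ u, Θ (u + 2 * Real.pi) = Θ u + k * (2 * Real.pi))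
    (hne : ∀ u, ∀ m : ℕ, 0 < m → m * halfPeriod a (Real.cos (2 * φ u)) ≠ k * Real.pi) (u : ℝ) :
    Real.cos (2 * φ u) = 0 := by
  have hpi := Real.pi_pos
  -- Rolle's theorem on one period provides a critical point of `φ`, from which the phase is
  -- measured.
  obtain ⟨u₀, -, h0⟩ := exists_hasDerivAt_eq_zero (f := φ) (f' := φ₁) (a := 0) (b := 2 * Real.pi)
    (by positivity) (fun u _ => (hφ u).continuousAt.continuousWithinAt)
    (by simpa using (hφper 0).symm) fun u _ => hφ u
  obtain ⟨ψ, hψ⟩ := exists_phase_of_profileEquation ha hφ hφ₁ hΘ hΘ₁ hmem hpos heq h0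
  set x₀ := Real.cos (2 * φ u₀) with hx₀_def
  have hx₀ : x₀ ∈ Ioo (-1 : ℝ) 1 := cos_two_mul_mem (hmem u₀)
  by_contra hu
  have hx₀ne : x₀ ≠ 0 := fun h => hu (by rw [(hψ u).1, h, zero_mul])
  obtain ⟨h1, h2⟩ := hψ (u₀ + 2 * Real.pi)
  rw [hφper, ← hx₀_def] at h1
  rw [hΘper, add_sub_cancel_left] at h2
  -- After one period `x` returns to `x₀ ≠ 0`, so the phase has grown by `2πn`, which is `2n` half
  -- periods; comparing angles gives `2n H = 2kπ`.
  have hcos : Real.cos (ψ (u₀ + 2 * Real.pi)) = 1 := mul_left_cancel₀ hx₀ne (by rw [← h1, mul_one])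
  obtain ⟨n, hn⟩ := (Real.cos_eq_one_iff _).1 hcos
  have hk' : (0 : ℝ) < k := by exact_mod_cast hk
  have hψpos : 0 < ψ (u₀ + 2 * Real.pi) := by
    rw [← (strictMono_phaseAngle ha hx₀).lt_iff_lt, phaseAngle_zero, h2]
    positivity
  have hnpos : 0 < n := by
    rw [← hn] at hψpos
    exact_mod_cast pos_of_mul_pos_left hψpos (by positivity)
  lift n to ℕ using hnpos.le
  have hn' : ψ (u₀ + 2 * Real.pi) = ((2 * n : ℕ) : ℝ) * Real.pi := by
    rw [← hn]; push_cast; ring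
  rw [hn', phaseAngle_nat_mul_pi ha hx₀] at h2
  refine hne u₀ n (by exact_mod_cast hnpos) ?_
  push_cast at h2
  linarith

/-! ### Circle invariant surfaces in polar form -/

/-- The complex number with components `p`, `q` with respect to the orthonormal basis
`e^{iθ}`, `i e^{iθ}`. -/
def framed (p q θ : ℝ) : ℂ := (p + q * Complex.I) * Complex.exp (θ * Complex.I)

lemma HasDerivAt.framed {p q θ : ℝ → ℝ} {p' q' θ' t : ℝ} (hp : HasDerivAt p p' t)
    (hq : HasDerivAt q q' t) (hθ : HasDerivAt θ θ' t) :
    HasDerivAt (fun t => framed (p t) (q t) (θ t))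
      (framed (p' - q t * θ') (q' + p t * θ') (θ t)) t := by
  refine ((hp.ofReal_comp.add (hq.ofReal_comp.mul_const Complex.I)).mul
    (hθ.ofReal_comp.mul_const Complex.I).cexp).congr_deriv ?_
  simp only [EllipsoidTori.framed, Pi.add_apply]
  push_cast
  linear_combination (q t * θ' * Complex.exp (θ t * Complex.I)) * Complex.I_mul_I

lemma inner_framed (p q n m θ : ℝ) : inner ℝ (framed p q θ) (framed n m θ) = p * n + q * m := by
  have h : starRingEnd ℂ (framed p q θ) * framed n m θ = (p - q * Complex.I) * (n + m * Complex.I) := by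
    have he : Complex.exp (-(θ * Complex.I)) * Complex.exp (θ * Complex.I) = 1 := by
      rw [← Complex.exp_add]; simp
    simp only [framed, map_mul, map_add, Complex.conj_ofReal, Complex.conj_I, ← Complex.exp_conj,
      mul_neg]
    linear_combination (p - q * Complex.I) * (n + m * Complex.I) * he
  rw [Complex.inner, mul_comm, h]
  simp

lemma framed_zero_zero (θ : ℝ) : framed 0 0 θ = 0 := by simp [framed]

lemma I_mul_framed (p θ : ℝ) : Complex.I * framed p 0 θ = framed 0 p θ := by
  simp [framed]; ring

lemma norm_framed (p θ : ℝ) : ‖framed p 0 θ‖ = |p| := by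
  simp [framed, Complex.norm_exp_ofReal_mul_I]

lemma contDiff_framed {E : Type*} [NormedAddCommGroup E] [NormedSpace ℝ E] {p θ : E → ℝ}
    (hp : ContDiff ℝ ∞ p) (hθ : ContDiff ℝ ∞ θ) : ContDiff ℝ ∞ fun x => framed (p x) 0 (θ x) := by
  have hof : ContDiff ℝ ∞ (fun x : ℝ => (x : ℂ)) := Complex.ofRealCLM.contDiff
  unfold framed
  exact ((hof.comp hp).add contDiff_const).mul ((hof.comp hθ).mul contDiff_const).cexp

/-- `F(u, v) = (a sin φ(u) e^{iΘ(u)}, cos φ(u) e^{iα(u, v)})`. -/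
structure IsPolarForm (a : ℝ) (F : ℝ × ℝ → ℂ × ℂ) (φ Θ : ℝ → ℝ) (α : ℝ × ℝ → ℝ) : Prop where
  smooth_φ : ContDiff ℝ ∞ φ
  smooth_Θ : ContDiff ℝ ∞ Θ
  smooth_α : ContDiff ℝ ∞ α
  eq : ∀ u v, F (u, v) =
    (framed (a * Real.sin (φ u)) 0 (Θ u), framed (Real.cos (φ u)) 0 (α (u, v)))

section Partial

variable {E : Type*} [NormedAddCommGroup E] [NormedSpace ℝ E] {G : ℝ × ℝ → E}

lemma hasDerivAt_fst_slice {u v : ℝ} (hG : DifferentiableAt ℝ G (u, v)) :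
    HasDerivAt (fun u => G (u, v)) (fderiv ℝ G (u, v) (1, 0)) u :=
  HasFDerivAt.comp_hasDerivAt (l := G) (f := fun u => (u, v)) u hG.hasFDerivAt
    ((hasDerivAt_id u).prodMk (hasDerivAt_const u v))

lemma hasDerivAt_snd_slice {u v : ℝ} (hG : DifferentiableAt ℝ G (u, v)) :
    HasDerivAt (fun v => G (u, v)) (fderiv ℝ G (u, v) (0, 1)) v :=
  HasFDerivAt.comp_hasDerivAt (l := G) (f := fun v => (u, v)) v hG.hasFDerivAt
    ((hasDerivAt_const v u).prodMk (hasDerivAt_id v))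

lemma contDiff_fderiv_apply (hG : ContDiff ℝ ∞ G) (e : ℝ × ℝ) :
    ContDiff ℝ ∞ fun p => fderiv ℝ G p e :=
  (hG.fderiv_right (m := ∞) (by simp)).clm_apply contDiff_const

end Partial

lemma contDiff_deriv {φ : ℝ → ℝ} (h : ContDiff ℝ ∞ φ) : ContDiff ℝ ∞ (deriv φ) :=
  (contDiff_infty_iff_deriv.1 h).2

lemma ContDiff.hasDerivAt_deriv {φ : ℝ → ℝ} (h : ContDiff ℝ ∞ φ) (u : ℝ) :
    HasDerivAt φ (deriv φ u) u := (h.differentiable (by simp) u).hasDerivAt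

namespace IsPolarForm

variable {a : ℝ} {F : ℝ × ℝ → ℂ × ℂ} {φ Θ : ℝ → ℝ} {α : ℝ × ℝ → ℝ}

lemma contDiff (h : IsPolarForm a F φ Θ α) : ContDiff ℝ ∞ F := by
  have e : F = fun p => (framed (a * Real.sin (φ p.1)) 0 (Θ p.1),
      framed (Real.cos (φ p.1)) 0 (α p)) := funext fun p => h.eq p.1 p.2
  rw [e]
  have hφ := h.smooth_φ.comp (contDiff_fst (𝕜 := ℝ) (E := ℝ) (F := ℝ))
  have hΘ := h.smooth_Θ.comp (contDiff_fst (𝕜 := ℝ) (E := ℝ) (F := ℝ))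
  exact (contDiff_framed (contDiff_const.mul (Real.contDiff_sin.comp hφ)) hΘ).prodMk
    (contDiff_framed (Real.contDiff_cos.comp hφ) h.smooth_α)

lemma du_eq (h : IsPolarForm a F φ Θ α) : du F = fun p =>
    (framed (a * Real.cos (φ p.1) * deriv φ p.1) (a * Real.sin (φ p.1) * deriv Θ p.1) (Θ p.1),
      framed (-Real.sin (φ p.1) * deriv φ p.1) (Real.cos (φ p.1) * fderiv ℝ α p (1, 0)) (α p)) := by
  funext ⟨u, v⟩
  have hφ := h.smooth_φ.hasDerivAt_deriv u
  have h1 := HasDerivAt.framed (hφ.sin.const_mul a) (hasDerivAt_const u (0 : ℝ))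
    (h.smooth_Θ.hasDerivAt_deriv u)
  have h2 := HasDerivAt.framed hφ.cos (hasDerivAt_const u (0 : ℝ))
    (hasDerivAt_fst_slice (h.smooth_α.differentiable (by simp) (u, v)))
  have h3 := (h1.prodMk h2).congr_of_eventuallyEq (.of_forall fun u => h.eq u v)
  rw [du, (hasDerivAt_fst_slice (h.contDiff.differentiable (by simp) (u, v))).unique h3]
  simp only [zero_mul, sub_zero, zero_add]
  ring_nf

lemma dv_eq (h : IsPolarForm a F φ Θ α) : dv F = fun p =>
    (0, framed 0 (Real.cos (φ p.1) * fderiv ℝ α p (0, 1)) (α p)) := by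
  funext ⟨u, v⟩
  have h2 := HasDerivAt.framed (hasDerivAt_const v (Real.cos (φ u))) (hasDerivAt_const v (0 : ℝ))
    (hasDerivAt_snd_slice (h.smooth_α.differentiable (by simp) (u, v)))
  have h3 := ((hasDerivAt_const v (framed (a * Real.sin (φ u)) 0 (Θ u))).prodMk
    h2).congr_of_eventuallyEq (.of_forall fun v => h.eq u v)
  rw [dv, (hasDerivAt_snd_slice (h.contDiff.differentiable (by simp) (u, v))).unique h3]
  simp only [zero_mul, sub_zero, zero_add]

/-- The component `b` along `i e^{iα}` can stay unspecified, since the normal used below has no such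
component. The same holds for the next two lemmas. -/
lemma dudu_eq (h : IsPolarForm a F φ Θ α) (u v : ℝ) : ∃ b : ℝ, du (du F) (u, v) =
    (framed (a * Real.cos (φ u) * deriv (deriv φ) u - a * Real.sin (φ u) * deriv φ u ^ 2 -
        a * Real.sin (φ u) * deriv Θ u ^ 2)
      (2 * a * Real.cos (φ u) * deriv φ u * deriv Θ u + a * Real.sin (φ u) * deriv (deriv Θ) u)
      (Θ u),
    framed (-Real.sin (φ u) * deriv (deriv φ) u - Real.cos (φ u) * deriv φ u ^ 2 -
      Real.cos (φ u) * fderiv ℝ α (u, v) (1, 0) ^ 2) b (α (u, v))) := by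
  have hφ := h.smooth_φ.hasDerivAt_deriv u
  have hΘ := h.smooth_Θ.hasDerivAt_deriv u
  have hφ' := (contDiff_deriv h.smooth_φ).hasDerivAt_deriv u
  have hΘ' := (contDiff_deriv h.smooth_Θ).hasDerivAt_deriv u
  have hα := hasDerivAt_fst_slice (h.smooth_α.differentiable (by simp) (u, v))
  have hα' := hasDerivAt_fst_slice
    ((contDiff_fderiv_apply h.smooth_α (1, 0)).differentiable (by simp) (u, v))
  have h1 := HasDerivAt.framed ((hφ.cos.const_mul a).mul hφ') ((hφ.sin.const_mul a).mul hΘ') hΘ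
  have h2 := HasDerivAt.framed (hφ.sin.neg.mul hφ') (hφ.cos.mul hα') hα
  have h3 := (h1.prodMk h2).congr_of_eventuallyEq
    (.of_forall fun u => congrFun h.du_eq (u, v))
  have hd : DifferentiableAt ℝ (du F) (u, v) :=
    (contDiff_fderiv_apply h.contDiff (1, 0)).differentiable (by simp) (u, v)
  rw [du, (hasDerivAt_fst_slice hd).unique h3]
  refine ⟨_, Prod.ext ?_ (congrArg₂ (fun x y => framed x y (α (u, v))) ?_ rfl)⟩
  · refine congrArg₂ (fun x y => framed x y (Θ u)) ?_ ?_
    · simp only [Pi.mul_apply]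
      ring
    · simp only [Pi.mul_apply]
      ring
  · simp only [Pi.mul_apply, Pi.neg_apply]
    ring

lemma dudv_eq (h : IsPolarForm a F φ Θ α) (u v : ℝ) : ∃ b : ℝ, du (dv F) (u, v) =
    (0, framed (-Real.cos (φ u) * fderiv ℝ α (u, v) (1, 0) * fderiv ℝ α (u, v) (0, 1)) b
      (α (u, v))) := by
  have hφ := h.smooth_φ.hasDerivAt_deriv u
  have hα := hasDerivAt_fst_slice (h.smooth_α.differentiable (by simp) (u, v))
  have hα' := hasDerivAt_fst_slice
    ((contDiff_fderiv_apply h.smooth_α (0, 1)).differentiable (by simp) (u, v))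
  have h2 := HasDerivAt.framed (hasDerivAt_const u (0 : ℝ)) (hφ.cos.mul hα') hα
  have h3 := ((hasDerivAt_const u (0 : ℂ)).prodMk h2).congr_of_eventuallyEq
    (.of_forall fun u => congrFun h.dv_eq (u, v))
  have hd : DifferentiableAt ℝ (dv F) (u, v) :=
    (contDiff_fderiv_apply h.contDiff (0, 1)).differentiable (by simp) (u, v)
  rw [du, (hasDerivAt_fst_slice hd).unique h3]
  refine ⟨_, Prod.ext rfl (congrArg₂ (fun x y => framed x y (α (u, v))) ?_ rfl)⟩
  simp only [Pi.mul_apply]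
  ring

lemma dvdv_eq (h : IsPolarForm a F φ Θ α) (u v : ℝ) : ∃ b : ℝ, dv (dv F) (u, v) =
    (0, framed (-Real.cos (φ u) * fderiv ℝ α (u, v) (0, 1) ^ 2) b (α (u, v))) := by
  have hα := hasDerivAt_snd_slice (h.smooth_α.differentiable (by simp) (u, v))
  have hα' := hasDerivAt_snd_slice
    ((contDiff_fderiv_apply h.smooth_α (0, 1)).differentiable (by simp) (u, v))
  have h2 := HasDerivAt.framed (hasDerivAt_const v (0 : ℝ)) (hα'.const_mul (Real.cos (φ u))) hα
  have h3 := ((hasDerivAt_const v (0 : ℂ)).prodMk h2).congr_of_eventuallyEq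
    (.of_forall fun v => congrFun h.dv_eq (u, v))
  have hd : DifferentiableAt ℝ (dv F) (u, v) :=
    (contDiff_fderiv_apply h.contDiff (0, 1)).differentiable (by simp) (u, v)
  rw [dv, (hasDerivAt_snd_slice hd).unique h3]
  refine ⟨_, Prod.ext rfl (congrArg₂ (fun x y => framed x y (α (u, v))) ?_ rfl)⟩
  ring

/-- The profile curve of a minimal torus in polar form is an unparametrized geodesic. -/
theorem profileEquation (h : IsPolarForm a F φ Θ α) (ha : 0 < a) (hF : IsMinimalTorus a F)
    (hmem : ∀ u, φ u ∈ Ioo 0 (Real.pi / 2)) (hα : ∀ p, fderiv ℝ α p (0, 1) ≠ 0) (u : ℝ) :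
    ProfileEquation a (φ u) (deriv φ u) (deriv (deriv φ) u) (deriv Θ u) (deriv (deriv Θ) u) := by
  obtain ⟨b₁, h1⟩ := h.dudu_eq u 0
  obtain ⟨b₂, h2⟩ := h.dudv_eq u 0
  obtain ⟨b₃, h3⟩ := h.dvdv_eq u 0
  have hc : 0 < Real.cos (φ u) := Real.cos_pos_of_mem_Ioo
    ⟨by linarith [(hmem u).1, Real.pi_pos], (hmem u).2⟩
  have hz := framed_zero_zero (Θ u)
  have hmin := hF.minimal (u, 0)
    -- In the tangent plane spanned by the meridian vector `(a cos φ e^{iΘ}, -sin φ e^{iα})` and `(i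
    -- e^{iΘ}, 0)`, this is the profile velocity turned by a right angle and rescaled.
    (framed (-a ^ 3 * Real.sin (φ u) * Real.cos (φ u) * deriv Θ u)
      (a * meridianFactor a (φ u) * deriv φ u) (Θ u),
     framed (a ^ 2 * Real.sin (φ u) ^ 2 * deriv Θ u) 0 (α (u, 0)))
  rw [h1, h2, h3, h.du_eq, h.dv_eq, h.eq, ← hz] at hmin
  simp only [IsTangent, dot, inner_framed] at hmin
  have hA := hα (u, 0)
  set A := fderiv ℝ α (u, 0) (0, 1)
  set B := fderiv ℝ α (u, 0) (1, 0)
  have hmin' := hmin (by field_simp; ring) (by unfold meridianFactor; ring) (by ring)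
  have hne : a ^ 2 * A ^ 2 * Real.cos (φ u) ≠ 0 :=
    mul_ne_zero (mul_ne_zero (pow_ne_zero 2 ha.ne') (pow_ne_zero 2 hA)) hc.ne'
  unfold ProfileEquation
  refine mul_left_cancel₀ hne ?_
  unfold meridianFactor at hmin' ⊢
  linear_combination -hmin'

end IsPolarForm

/-! ### Lifting angles -/

/-- The angle of `f p` relative to `e^{i b(p)}`, in `(-π, π]`. -/
def relativeArg {X : Type*} (f : X → ℂ) (b : X → ℝ) (p : X) : ℝ :=
  Complex.arg (f p * Complex.exp ((-b p : ℝ) * Complex.I))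

lemma eq_framed_relativeArg {X : Type*} (f : X → ℂ) (b : X → ℝ) (p : X) :
    f p = framed ‖f p‖ 0 (b p + relativeArg f b p) := by
  set w := f p * Complex.exp ((-b p : ℝ) * Complex.I) with hw
  have h1 := Complex.norm_mul_exp_arg_mul_I w
  have h2 : ‖w‖ = ‖f p‖ := by rw [hw, norm_mul, Complex.norm_exp_ofReal_mul_I, mul_one]
  have h3 : f p = w * Complex.exp (b p * Complex.I) := by
    rw [hw, mul_assoc, ← Complex.exp_add]
    simp
  rw [h2] at h1
  conv_lhs => rw [h3, ← h1]
  rw [framed, show relativeArg f b p = w.arg from rfl, mul_assoc, ← Complex.exp_add]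
  push_cast
  rw [zero_mul, add_zero]
  congr 2
  ring

lemma relativeArg_congr {X : Type*} {f : X → ℂ} {b : X → ℝ} {p q : X} (n : ℕ) (hf : f q = f p)
    (hb : b q = b p + n * (2 * Real.pi)) : relativeArg f b q = relativeArg f b p := by
  have : Complex.exp ((-b q : ℝ) * Complex.I) = Complex.exp ((-b p : ℝ) * Complex.I) := by
    refine Complex.exp_eq_exp_iff_exists_int.2 ⟨-n, ?_⟩
    rw [hb]
    push_cast
    ring
  rw [relativeArg, relativeArg, hf, this]

lemma abs_relativeArg_le {X : Type*} (f : X → ℂ) (b : X → ℝ) (p : X) :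
    |relativeArg f b p| ≤ Real.pi := Complex.abs_arg_le_pi _

/-- The hypothesis places `f e^{-ib}` in the right half plane, where the principal logarithm is
smooth. Angles thus lift by a global formula, without covering theory. -/
lemma contDiff_relativeArg {E : Type*} [NormedAddCommGroup E] [NormedSpace ℝ E] {f : E → ℂ}
    {b : E → ℝ} {A : ℝ} (hf : ContDiff ℝ ∞ f) (hb : ContDiff ℝ ∞ b)
    (h : ∀ p, ‖f p - framed A 0 (b p)‖ < A) : ContDiff ℝ ∞ (relativeArg f b) := by
  have hof : ContDiff ℝ ∞ (fun x : ℝ => (x : ℂ)) := Complex.ofRealCLM.contDiff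
  have hw : ContDiff ℝ ∞ fun p => f p * Complex.exp ((-b p : ℝ) * Complex.I) :=
    hf.mul ((hof.comp hb.neg).mul contDiff_const).cexp
  rw [contDiff_iff_contDiffAt]
  intro p
  have hre : 0 < (f p * Complex.exp ((-b p : ℝ) * Complex.I)).re := by
    have h1 : (f p - framed A 0 (b p)) * Complex.exp ((-b p : ℝ) * Complex.I) =
        f p * Complex.exp ((-b p : ℝ) * Complex.I) - A := by
      rw [framed, sub_mul, mul_assoc, ← Complex.exp_add]
      simp
    have h2 : ‖(f p - framed A 0 (b p)) * Complex.exp ((-b p : ℝ) * Complex.I)‖ < A := by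
      rw [norm_mul, Complex.norm_exp_ofReal_mul_I, mul_one]
      exact h p
    rw [h1] at h2
    have h3 := (Complex.abs_re_le_norm _).trans_lt h2
    rw [Complex.sub_re, Complex.ofReal_re] at h3
    linarith [(abs_lt.1 h3).1]
  have hlog := (Complex.contDiffAt_log (n := ∞) (Or.inl hre)).restrict_scalars ℝ
  have := Complex.imCLM.contDiff.contDiffAt.comp p (hlog.comp p hw.contDiffAt)
  refine this.congr_of_eventuallyEq (.of_forall fun q => ?_)
  exact (Complex.log_im _).symm

/-- If `d` is the velocity of `z`, this inner product is `|z|²` times the angular velocity. For the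
model it equals `κA²`, and the errors are at most `κA²/4 + 5A²/16`. -/
lemma inner_I_mul_pos {z d : ℂ} {A θ κ δ : ℝ} (hA : 0 < A) (hκ : 1 ≤ κ) (hδ : δ ≤ A / 4)
    (hz : ‖z - framed A 0 θ‖ < δ) (hd : ‖d - framed 0 (κ * A) θ‖ < δ) :
    0 < inner ℝ (Complex.I * z) d := by
  set z₀ := framed A 0 θ
  set d₀ := framed 0 (κ * A) θ with hd₀
  have hz₀n : ‖z₀‖ = A := by rw [norm_framed, abs_of_pos hA]
  have hd₀n : ‖d₀‖ = κ * A := by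
    rw [hd₀, ← I_mul_framed, norm_mul, norm_framed, Complex.norm_I, one_mul,
      abs_of_pos (by positivity)]
  have h0 : inner ℝ (Complex.I * z₀) d₀ = κ * A ^ 2 := by
    rw [I_mul_framed, inner_framed]; ring
  have hsplit : inner ℝ (Complex.I * z) d = inner ℝ (Complex.I * z₀) d₀ +
      inner ℝ (Complex.I * (z - z₀)) d₀ + inner ℝ (Complex.I * z) (d - d₀) := by
    rw [mul_sub, inner_sub_left, inner_sub_right]; ring
  have h1 := (abs_le.1 (abs_real_inner_le_norm (Complex.I * (z - z₀)) d₀)).1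
  have h2 := (abs_le.1 (abs_real_inner_le_norm (Complex.I * z) (d - d₀))).1
  rw [norm_mul, Complex.norm_I, one_mul] at h1 h2
  have hzn : ‖z‖ ≤ A + δ := by
    have := norm_sub_norm_le z z₀
    linarith
  rw [hsplit, h0]
  rw [hd₀n] at h1
  have hδ0 : 0 < δ := (norm_nonneg _).trans_lt hz
  have e1 : ‖z - z₀‖ * (κ * A) ≤ A / 4 * (κ * A) :=
    mul_le_mul_of_nonneg_right (by linarith) (by positivity)
  have e2 : ‖z‖ * ‖d - d₀‖ ≤ (A + A / 4) * (A / 4) :=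
    mul_le_mul (by linarith) (by linarith) (norm_nonneg _) (by positivity)
  have e3 : A ^ 2 ≤ κ * A ^ 2 := le_mul_of_one_le_left (by positivity) hκ
  nlinarith [sq_nonneg A, pow_pos hA 2]

/-! ### The covering of the Clifford torus and the tori close to it. -/

lemma cliffordCover_eq (a : ℝ) (k : ℕ) (u v : ℝ) : cliffordCover a k (u, v) =
    (framed (a / √2) 0 (k * u), framed (1 / √2) 0 v) := by
  simp [cliffordCover, framed]

lemma isPolarForm_cliffordCover (a : ℝ) (k : ℕ) :
    IsPolarForm a (cliffordCover a k) (fun _ => Real.pi / 4) (fun u => k * u) Prod.snd where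
  smooth_φ := contDiff_const
  smooth_Θ := contDiff_const.mul contDiff_id
  smooth_α := contDiff_snd
  eq u v := by
    have h : √2 / 2 = 1 / √2 := Real.sqrt_div_self'
    rw [cliffordCover_eq, Real.sin_pi_div_four, Real.cos_pi_div_four, h]
    congr 2
    ring

lemma du_cliffordCover (a : ℝ) (k : ℕ) (p : ℝ × ℝ) :
    (du (cliffordCover a k) p).1 = framed 0 (k * (a / √2)) (k * p.1) := by
  rw [(isPolarForm_cliffordCover a k).du_eq, Real.sin_pi_div_four]
  have h : √2 / 2 = 1 / √2 := Real.sqrt_div_self'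
  have hd : deriv (fun u : ℝ => (k : ℝ) * u) p.1 = k := by
    simp
  simp only [deriv_const, mul_zero, hd, h]
  congr 1
  ring

lemma dv_cliffordCover (a : ℝ) (k : ℕ) (p : ℝ × ℝ) :
    (dv (cliffordCover a k) p).2 = framed 0 (1 * (1 / √2)) p.2 := by
  rw [(isPolarForm_cliffordCover a k).dv_eq, Real.cos_pi_div_four]
  have h : √2 / 2 = 1 / √2 := Real.sqrt_div_self'
  simp [fderiv_snd, h]

/-- A circle invariant minimal torus that is close to a covering of the Clifford torus has a
polar form, and its angles wind like those of the Clifford torus. -/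
theorem exists_isPolarForm {a δ : ℝ} (ha : 0 < a) {k : ℕ} (hk : 0 < k)
    (hδa : δ ≤ a / √2 / 4) (hδ1 : δ ≤ 1 / √2 / 4) {F : ℝ × ℝ → ℂ × ℂ} (hF : IsMinimalTorus a F)
    (hinv : IsCircleInvariant F) (hclose : C1Close δ F (cliffordCover a k)) :
    ∃ (φ Θ : ℝ → ℝ) (α : ℝ × ℝ → ℝ), IsPolarForm a F φ Θ α ∧
      (∀ u, φ u ∈ Ioo 0 (Real.pi / 2)) ∧ (∀ u, 0 < deriv Θ u) ∧
      (∀ p, 0 < fderiv ℝ α p (0, 1)) ∧ (∀ u, |Real.cos (2 * φ u)| < 4 * δ) ∧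
      (∀ u, φ (u + 2 * Real.pi) = φ u) ∧ (∀ u, Θ (u + 2 * Real.pi) = Θ u + k * (2 * Real.pi)) ∧
      (∀ u v, α (u + 2 * Real.pi, v) = α (u, v)) ∧
      (∀ u v, α (u, v + 2 * Real.pi) = α (u, v) + 2 * Real.pi) ∧
      (∀ u, |Θ u - k * u| ≤ Real.pi) ∧ ∀ p, |α p - p.2| ≤ Real.pi := by
  have hpi := Real.pi_pos
  have h2 : 0 < √(2 : ℝ) := by positivity
  have hA : 0 < a / √2 := by positivity
  have hr : 0 < 1 / √2 := by positivity
  have hk1 : (1 : ℝ) ≤ k := by exact_mod_cast hk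
  have hc1 : ∀ p : ℝ × ℝ, ‖(F p).1 - framed (a / √2) 0 (k * p.1)‖ < δ := fun p => by
    have := (norm_fst_le _).trans_lt (hclose p).1
    rwa [Prod.fst_sub, cliffordCover_eq a k p.1 p.2] at this
  have hc2 : ∀ p : ℝ × ℝ, ‖(F p).2 - framed (1 / √2) 0 p.2‖ < δ := fun p => by
    have := (norm_snd_le _).trans_lt (hclose p).1
    rwa [Prod.snd_sub, cliffordCover_eq a k p.1 p.2] at this
  have hd : ∀ (p e : ℝ × ℝ), ‖e‖ = 1 →
      ‖fderiv ℝ F p e - fderiv ℝ (cliffordCover a k) p e‖ < δ := fun p e he => by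
    have := (fderiv ℝ F p - fderiv ℝ (cliffordCover a k) p).le_opNorm e
    rw [he, mul_one] at this
    exact this.trans_lt (hclose p).2
  have hd1 : ∀ p : ℝ × ℝ, ‖(du F p).1 - framed 0 (k * (a / √2)) (k * p.1)‖ < δ := fun p => by
    have := (norm_fst_le _).trans_lt (hd p (1, 0) (by simp [Prod.norm_def]))
    rw [← du_cliffordCover]
    exact this
  have hd2 : ∀ p : ℝ × ℝ, ‖(dv F p).2 - framed 0 (1 * (1 / √2)) p.2‖ < δ := fun p => by
    have := (norm_snd_le _).trans_lt (hd p (0, 1) (by simp [Prod.norm_def]))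
    rw [← dv_cliffordCover a k]
    exact this
  have hinv1 : ∀ u v, (F (u, v)).1 = (F (u, 0)).1 := fun u v => by
    obtain ⟨t, ht⟩ := hinv u v
    rw [ht]
  have hinv2 : ∀ u v, ‖(F (u, v)).2‖ = ‖(F (u, 0)).2‖ := fun u v => by
    obtain ⟨t, ht⟩ := hinv u v
    rw [ht]
    simp only
    rw [norm_mul, Complex.norm_exp_ofReal_mul_I, one_mul]
  set f₁ : ℝ → ℂ := fun u => (F (u, 0)).1 with hf₁
  set f₂ : ℝ × ℝ → ℂ := fun p => (F p).2 with hf₂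
  have hs0 : ContDiff ℝ ∞ fun u : ℝ => F (u, 0) :=
    hF.smooth.comp (contDiff_id.prodMk contDiff_const)
  have hs1 : ContDiff ℝ ∞ f₁ := contDiff_fst.comp hs0
  have hs2 : ContDiff ℝ ∞ f₂ := contDiff_snd.comp hF.smooth
  set r : ℝ → ℝ := fun u => ‖(F (u, 0)).2‖ with hr_def
  have hnear : ∀ {z : ℂ} {A θ : ℝ}, 0 < A → ‖z - framed A 0 θ‖ < δ → |‖z‖ - A| < δ := by
    intro z A θ hA h
    have := abs_norm_sub_norm_le z (framed A 0 θ)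
    rw [norm_framed, abs_of_pos hA] at this
    exact this.trans_lt h
  have hr_near : ∀ u, |r u - 1 / √2| < δ := fun u => hnear hr (hc2 (u, 0))
  have hR_near : ∀ u, |‖f₁ u‖ - a / √2| < δ := fun u => hnear hA (hc1 (u, 0))
  have hr_pos : ∀ u, 0 < r u := fun u => by linarith [(abs_lt.1 (hr_near u)).1]
  have hR_pos : ∀ u, 0 < ‖f₁ u‖ := fun u => by linarith [(abs_lt.1 (hR_near u)).1]
  have hell : ∀ u, ‖f₁ u‖ ^ 2 / a ^ 2 + r u ^ 2 = 1 := fun u => hF.mem (u, 0)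
  have hr_lt : ∀ u, r u < 1 := fun u => by
    have h1 : 0 < ‖f₁ u‖ ^ 2 / a ^ 2 := div_pos (pow_pos (hR_pos u) 2) (by positivity)
    nlinarith [hell u, hr_pos u]
  set φ : ℝ → ℝ := fun u => Real.arccos (r u) with hφ_def
  set Θ : ℝ → ℝ := fun u => k * u + relativeArg f₁ (fun u => k * u) u with hΘ_def
  set α : ℝ × ℝ → ℝ := fun p => p.2 + relativeArg f₂ Prod.snd p with hα_def
  have hcos : ∀ u, Real.cos (φ u) = r u := fun u =>
    Real.cos_arccos (by linarith [hr_pos u]) (hr_lt u).le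
  have hsin : ∀ u, a * Real.sin (φ u) = ‖f₁ u‖ := fun u => by
    have h1 : 1 - r u ^ 2 = (‖f₁ u‖ / a) ^ 2 := by rw [div_pow]; linarith [hell u]
    simp only [hφ_def]
    rw [Real.sin_arccos, h1, Real.sqrt_sq (div_nonneg (norm_nonneg _) ha.le),
      mul_div_cancel₀ _ ha.ne']
  have hpol : IsPolarForm a F φ Θ α := by
    refine ⟨?_, ?_, ?_, fun u v => Prod.ext ?_ ?_⟩
    · rw [contDiff_iff_contDiffAt]
      intro u
      have h1 : ContDiffAt ℝ ∞ r u := by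
        have := (contDiff_snd.comp hs0).contDiffAt (x := u)
        exact this.norm ℝ (norm_pos_iff.1 (hr_pos u))
      exact (Real.contDiffAt_arccos (by linarith [hr_pos u]) (hr_lt u).ne).comp u h1
    · exact (contDiff_const.mul contDiff_id).add (contDiff_relativeArg (A := a / √2) hs1
        (contDiff_const.mul contDiff_id) fun u => (hc1 (u, 0)).trans_le (by linarith))
    · exact contDiff_snd.add (contDiff_relativeArg (A := 1 / √2) hs2 contDiff_snd
        fun p => (hc2 p).trans_le (by linarith))
    · rw [hsin]
      exact (hinv1 u v).trans (eq_framed_relativeArg f₁ (fun u => k * u) u)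
    · rw [hcos]
      simp only [hr_def]
      rw [← hinv2 u v]
      exact eq_framed_relativeArg f₂ Prod.snd (u, v)
  have hφmem : ∀ u, φ u ∈ Ioo 0 (Real.pi / 2) := fun u =>
    ⟨Real.arccos_pos.2 (hr_lt u), Real.arccos_lt_pi_div_two.2 (hr_pos u)⟩
  refine ⟨φ, Θ, α, hpol, hφmem, fun u => ?_, fun p => ?_, fun u => ?_, fun u => ?_, fun u => ?_,
    fun u v => ?_, fun u v => ?_, fun u => ?_, fun p => ?_⟩
  -- In polar form the inner product is `(a sin φ)² Θ'`, so its sign is that of `Θ'`; the same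
  -- argument applies to `∂α/∂v`.
  · have h := inner_I_mul_pos hA hk1 hδa (hc1 (u, 0)) (hd1 (u, 0))
    rw [hpol.eq, hpol.du_eq] at h
    simp only at h
    rw [I_mul_framed, inner_framed, zero_mul, zero_add] at h
    refine pos_of_mul_pos_right ?_ (sq_nonneg (a * Real.sin (φ u)))
    linarith
  · have h := inner_I_mul_pos hr le_rfl hδ1 (hc2 p) (hd2 p)
    rw [hpol.eq p.1 p.2, hpol.dv_eq] at h
    simp only at h
    rw [I_mul_framed, inner_framed, zero_mul, zero_add] at h
    refine pos_of_mul_pos_right ?_ (sq_nonneg (Real.cos (φ p.1)))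
    linarith
  -- With `r = cos φ`, `cos 2φ = 2 (r - 1/√2)(r + 1/√2)`; the last factor is below 2, whence the
  -- bound `4δ`.
  · have h22 : (1 / √2 : ℝ) ^ 2 = 1 / 2 := by rw [div_pow, Real.sq_sqrt zero_le_two, one_pow]
    have h3 : Real.cos (2 * φ u) = 2 * (r u - 1 / √2) * (r u + 1 / √2) := by
      rw [Real.cos_two_mul, hcos]
      linear_combination 2 * h22
    have h4 : 1 / √2 < 1 := by nlinarith
    rw [h3, abs_mul, abs_mul, abs_two, abs_of_pos (add_pos (hr_pos u) hr)]
    have h5 := hr_near u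
    have h6 := hr_lt u
    have h7 := abs_nonneg (r u - 1 / √2)
    have h8 := hr_pos u
    nlinarith
  · simp only [hφ_def, hr_def, hF.periodic_u]
  · have := relativeArg_congr (f := f₁) (b := fun u => k * u) (p := u) (q := u + 2 * Real.pi) k
      (by simp only [hf₁, hF.periodic_u]) (by ring)
    simp only [hΘ_def, this]
    ring
  · have := relativeArg_congr (f := f₂) (b := Prod.snd) (p := (u, v)) (q := (u + 2 * Real.pi, v)) 0
      (by simp only [hf₂, hF.periodic_u]) (by simp)
    simp only [hα_def, this]
  · have := relativeArg_congr (f := f₂) (b := Prod.snd) (p := (u, v)) (q := (u, v + 2 * Real.pi)) 1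
      (by simp only [hf₂, hF.periodic_v]) (by simp)
    simp only [hα_def, this]
    ring
  · simp only [hΘ_def, add_sub_cancel_left]
    exact abs_relativeArg_le _ _ _
  · simp only [hα_def, add_sub_cancel_left]
    exact abs_relativeArg_le _ _ _

/-! ### Reparametrizations of the torus -/

lemma surjective_of_abs_sub_mul_le {f : ℝ → ℝ} (hf : Continuous f) {c C : ℝ} (hc : 0 < c)
    (h : ∀ x, |f x - c * x| ≤ C) : Function.Surjective f := by
  refine hf.surjective ?_ ?_
  · refine tendsto_atTop_mono (f := fun x => -C + c * x) (fun x => ?_)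
      (tendsto_atTop_add_const_left _ _ (tendsto_id.const_mul_atTop hc))
    linarith [(abs_le.1 (h x)).1]
  · refine tendsto_atBot_mono (f := fun x => C + c * x) (fun x => ?_)
      (tendsto_atBot_add_const_left _ _ (tendsto_id.const_mul_atBot hc))
    linarith [(abs_le.1 (h x)).2]

/-- The inverse of a smooth bijection with injective differentials is smooth. -/
lemma contDiff_symm_of_injective_fderiv {E : Type*} [NormedAddCommGroup E] [NormedSpace ℝ E]
    [FiniteDimensional ℝ E] (Φ : E ≃ E) (hΦ : ContDiff ℝ ∞ Φ)
    (hinj : ∀ p, Function.Injective (fderiv ℝ Φ p)) : ContDiff ℝ ∞ Φ.symm := by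
  have := FiniteDimensional.complete ℝ E
  rw [contDiff_iff_contDiffAt]
  intro q
  obtain ⟨p, rfl⟩ := Φ.surjective q
  let e : E ≃L[ℝ] E :=
    (LinearEquiv.ofInjectiveEndo (fderiv ℝ Φ p : E →ₗ[ℝ] E) (hinj p)).toContinuousLinearEquiv
  have hd : HasFDerivAt Φ (e : E →L[ℝ] E) p := by
    have he : (e : E →L[ℝ] E) = fderiv ℝ Φ p := by ext; rfl
    rw [he]
    exact (hΦ.differentiable (by simp) p).hasFDerivAt
  have hc := hΦ.contDiffAt (x := p)
  have hne : (∞ : WithTop ℕ∞) ≠ 0 := by simp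
  refine (hc.to_localInverse hd hne).congr_of_eventuallyEq ?_
  filter_upwards [(hc.hasStrictFDerivAt' hd hne).eventually_right_inverse] with y hy
  rw [Equiv.symm_apply_eq]
  exact hy.symm

lemma fderiv_eq_of_partials {E : Type*} [NormedAddCommGroup E] [NormedSpace ℝ E] {G : ℝ × ℝ → E}
    (p h : ℝ × ℝ) : fderiv ℝ G p h = h.1 • fderiv ℝ G p (1, 0) + h.2 • fderiv ℝ G p (0, 1) := by
  rw [← map_smul, ← map_smul, ← map_add]
  simp

/-- The angles of a torus in polar form define a reparametrization. -/
lemma exists_isTorusReparam {Θ : ℝ → ℝ} {α : ℝ × ℝ → ℝ} {k : ℕ} (hk : 0 < k)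
    (hΘ : ContDiff ℝ ∞ Θ) (hα : ContDiff ℝ ∞ α) (hΘ' : ∀ u, 0 < deriv Θ u)
    (hα' : ∀ p, 0 < fderiv ℝ α p (0, 1))
    (hΘper : ∀ u, Θ (u + 2 * Real.pi) = Θ u + k * (2 * Real.pi))
    (hαu : ∀ u v, α (u + 2 * Real.pi, v) = α (u, v))
    (hαv : ∀ u v, α (u, v + 2 * Real.pi) = α (u, v) + 2 * Real.pi)
    (hΘb : ∀ u, |Θ u - k * u| ≤ Real.pi) (hαb : ∀ p, |α p - p.2| ≤ Real.pi) :
    ∃ Φ : ℝ × ℝ ≃ ℝ × ℝ, IsTorusReparam Φ ∧ ∀ u v, Φ (u, v) = (Θ u / k, α (u, v)) := by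
  have hk' : (0 : ℝ) < k := by exact_mod_cast hk
  have hΘmono : StrictMono Θ := strictMono_of_deriv_pos hΘ'
  have hαd := fun u v => hasDerivAt_snd_slice (hα.differentiable (by simp) (u, v))
  have hαmono : ∀ u, StrictMono fun v => α (u, v) := fun u =>
    strictMono_of_deriv_pos fun v => by rw [(hαd u v).deriv]; exact hα' _
  have hΘsurj := surjective_of_abs_sub_mul_le hΘ.continuous hk' hΘb
  have hαsurj : ∀ u, Function.Surjective fun v => α (u, v) := fun u =>
    surjective_of_abs_sub_mul_le (by have := hα.continuous; fun_prop) one_pos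
      fun v => by simpa using hαb (u, v)
  let Ψ : ℝ × ℝ → ℝ × ℝ := fun p => (Θ p.1 / k, α p)
  have hΨ : Function.Bijective Ψ := by
    constructor
    · rintro ⟨u, v⟩ ⟨u', v'⟩ h
      obtain ⟨h1, h2⟩ := Prod.ext_iff.1 h
      have hu : u = u' := hΘmono.injective ((div_left_inj' hk'.ne').1 h1)
      subst hu
      rw [(hαmono u).injective h2]
    · rintro ⟨x, y⟩
      obtain ⟨u, hu⟩ := hΘsurj (k * x)
      obtain ⟨v, hv⟩ := hαsurj u y
      refine ⟨(u, v), Prod.ext ?_ hv⟩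
      simp only [Ψ, hu]
      field_simp
  have hsm : ContDiff ℝ ∞ Ψ := ((hΘ.comp contDiff_fst).div_const _).prodMk hα
  -- The differential is triangular with positive diagonal entries `Θ'/k` and `∂α/∂v`.
  have hinj : ∀ p, Function.Injective (fderiv ℝ Ψ p) := by
    intro p
    rw [injective_iff_map_eq_zero]
    intro h hh
    have hd1 : HasFDerivAt (fun p : ℝ × ℝ => Θ p.1 / k)
        ((ContinuousLinearMap.toSpanSingleton ℝ (deriv Θ p.1 / k)).comp
          (ContinuousLinearMap.fst ℝ ℝ ℝ)) p :=
      ((hΘ.hasDerivAt_deriv p.1).div_const (k : ℝ)).hasFDerivAt.comp p hasFDerivAt_fst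
    have hd := hd1.prodMk (hα.differentiable (by simp) p).hasFDerivAt
    rw [show Ψ = fun p : ℝ × ℝ => (Θ p.1 / k, α p) from rfl, hd.fderiv] at hh
    obtain ⟨e1, e2⟩ := Prod.ext_iff.1 hh
    have h1 : h.1 * (deriv Θ p.1 / k) = 0 := e1
    have h1' : h.1 = 0 := (mul_eq_zero.1 h1).resolve_right (div_pos (hΘ' _) hk').ne'
    have h2 : fderiv ℝ α p h = 0 := e2
    rw [fderiv_eq_of_partials, h1', zero_smul, zero_add, smul_eq_mul] at h2
    exact Prod.ext h1' ((mul_eq_zero.1 h2).resolve_right (hα' p).ne')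
  refine ⟨Equiv.ofBijective Ψ hΨ, ⟨hsm, contDiff_symm_of_injective_fderiv _ hsm hinj,
    fun u v => Prod.ext ?_ ?_, fun u v => Prod.ext ?_ ?_⟩, fun u v => rfl⟩
  · change Θ (u + 2 * Real.pi) / k = Θ u / k + 2 * Real.pi
    rw [hΘper]
    field_simp
  · change α (u + 2 * Real.pi, v) = α (u, v) + 0
    rw [hαu, add_zero]
  · exact (add_zero _).symm
  · exact hαv u v

/-- Local uniqueness of the coverings of the Clifford torus that are not bifurcation instants. -/
theorem exists_forall_eq_cliffordCover_comp {k : ℕ} (hk : 0 < k) {a : ℝ} (ha : 0 < a)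
    (hne : ∀ j : ℕ, 0 < j → j < 2 * k → a ≠ bifInstant j k) :
    ∃ δ : ℝ, 0 < δ ∧ ∀ F : ℝ × ℝ → ℂ × ℂ,
      IsMinimalTorus a F → IsCircleInvariant F → C1Close δ F (cliffordCover a k) →
      ∃ Φ : ℝ × ℝ ≃ ℝ × ℝ, IsTorusReparam Φ ∧ F = cliffordCover a k ∘ Φ := by
  have h0 : (0 : ℝ) ∈ Ioo (-1 : ℝ) 1 := by norm_num
  have hcont : ContinuousAt (fun x => halfPeriod a x) 0 :=
    ContinuousAt.comp (g := fun p : ℝ × ℝ => halfPeriod p.1 p.2) (f := fun x => (a, x))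
      (contDiffAt_halfPeriod ha h0).continuousAt (by fun_prop)
  have hev := eventually_nat_mul_ne hcont (halfPeriod_pos ha h0) (P := fun m => 0 < m)
    (c := k * Real.pi) fun m hm h => by
      obtain ⟨h1, h2⟩ := (nat_mul_halfPeriod_zero_eq_iff ha hm hk).1 h
      exact hne m hm h1 h2
  obtain ⟨ε, hε, hball⟩ := Metric.eventually_nhds_iff_ball.1 hev
  have h2 : 0 < √(2 : ℝ) := by positivity
  -- The bound `ε / 4` matches `|cos 2φ| < 4δ`; the other two are those required for the polar form.
  refine ⟨min (ε / 4) (min (a / √2 / 4) (1 / √2 / 4)), by positivity, fun F hF hinv hclose => ?_⟩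
  obtain ⟨φ, Θ, α, hpol, hmem, hΘ', hα', hsmall, hφper, hΘper, hαu, hαv, hΘb, hαb⟩ :=
    exists_isPolarForm ha hk ((min_le_right _ _).trans (min_le_left _ _))
      ((min_le_right _ _).trans (min_le_right _ _)) hF hinv hclose
  have hcos := cos_eq_zero_of_periodic ha hk hpol.smooth_φ.hasDerivAt_deriv
    (contDiff_deriv hpol.smooth_φ).hasDerivAt_deriv hpol.smooth_Θ.hasDerivAt_deriv
    (contDiff_deriv hpol.smooth_Θ).hasDerivAt_deriv hmem hΘ'
    (hpol.profileEquation ha hF hmem fun p => (hα' p).ne') hφper hΘper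
    fun u m hm => hball _ (by
      rw [mem_ball_zero_iff, Real.norm_eq_abs]
      have := hsmall u
      have := min_le_left (ε / 4) (min (a / √2 / 4) (1 / √2 / 4))
      linarith) m hm
  have hφ : ∀ u, φ u = Real.pi / 4 := fun u => by
    have h1 := hmem u
    have : 2 * φ u = Real.pi / 2 := Real.injOn_cos
      ⟨by linarith [h1.1], by linarith [h1.2]⟩ ⟨by positivity, by linarith [Real.pi_pos]⟩
      (by rw [hcos, Real.cos_pi_div_two])
    linarith
  obtain ⟨Φ, hΦ, hΦeq⟩ := exists_isTorusReparam hk hpol.smooth_Θ hpol.smooth_α hΘ' hα' hΘper hαu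
    hαv hΘb hαb
  refine ⟨Φ, hΦ, funext fun ⟨u, v⟩ => ?_⟩
  have hk' : (k : ℝ) ≠ 0 := by exact_mod_cast hk.ne'
  rw [Function.comp_apply, hΦeq, (isPolarForm_cliffordCover a k).eq, hpol.eq, hφ,
    mul_div_cancel₀ _ hk']

end

end EllipsoidTori

theorem mainTheorem3 (β : ℝ → ℝ → ℝ) (hβ : IsRadialParametrization β) (k : ℕ) (hk : 0 < k) :
    -- the geodesics `γ_{a,s}` and the times `ℓ_k(a,s)` that define `f_k` exist and are unique
    (∀ a s : ℝ, (a, s) ∈ strip →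
      (∃! γ : ℝ → ℝ × ℝ, IsOrthogonalGeodesic β a s γ) ∧
      (∃! t : ℝ, 0 < t ∧ (orthGeodesic β a s t).2 = k * Real.pi)) ∧
    -- (i)
    (∀ j : ℕ, 0 < j → j < 2 * k →
      ∃ U : Set (ℝ × ℝ), IsOpen U ∧ U ⊆ strip ∧ (bifInstant j k, 0) ∈ U ∧
      ∃ ε : ℝ, 0 < ε ∧ ∃ A S : ℝ → ℝ,
        AnalyticOnNhd ℝ A (Set.Ioo (-ε) ε) ∧ AnalyticOnNhd ℝ S (Set.Ioo (-ε) ε) ∧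
        (∀ t ∈ Set.Ioo (-ε) ε, (A t, S t) ∈ U) ∧
        A 0 = bifInstant j k ∧ S 0 = 0 ∧ 0 < deriv S 0 ∧
        zeroSet β k ∩ U =
          (trivialBranch ∩ U) ∪ (fun t => (A t, S t)) '' Set.Ioo (-ε) ε) ∧
    -- (ii)
    (∀ a : ℝ, 0 < a → (∀ j : ℕ, 0 < j → j < 2 * k → a ≠ bifInstant j k) →
      ∃ V : Set (ℝ × ℝ), IsOpen V ∧ V ⊆ strip ∧ (a, 0) ∈ V ∧
        zeroSet β k ∩ V = trivialBranch ∩ V) ∧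
    -- the consequence for minimal tori
    (∀ a : ℝ, 0 < a → (∀ j : ℕ, 0 < j → j < 2 * k → a ≠ bifInstant j k) →
      ∃ δ : ℝ, 0 < δ ∧ ∀ F : ℝ × ℝ → ℂ × ℂ,
        IsMinimalTorus a F → IsCircleInvariant F → C1Close δ F (cliffordCover a k) →
        ∃ Φ : ℝ × ℝ ≃ ℝ × ℝ, IsTorusReparam Φ ∧ F = cliffordCover a k ∘ Φ) := by
  have hk' : (0 : ℝ) < k := by exact_mod_cast hk
  exact ⟨fun a s h => ⟨existsUnique_isOrthogonalGeodesic hβ h,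
      existsUnique_hittingTime hβ h (mul_pos hk' Real.pi_pos)⟩,
    fun j hj hjk => exists_bifurcating_branch hβ hj hjk,
    fun a ha hne => exists_nhd_zeroSet_eq_trivialBranch hβ hk ha hne,
    fun a ha hne => exists_forall_eq_cliffordCover_comp hk ha hne⟩
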